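/- **Model.** In the synchronous message passing model, an $n$-vertex graph $G=(V,E)$ of maximum degree $\Delta$ is given, whose vertices host processors. The vertices have distinct identity numbers in $\{0,1,\dots,n^{\kappa}\}$, where $\kappa$ is a constant, and know $n$, $\kappa$, $\Delta$ and $t$. In each round every vertex sends a message to all its neighbours and receives theirs; local computation is free. Logarithms have base $2$, $\log^{(0)}x=x$, $\log^{(i+1)}x=\log(\log^{(i)}x)$, and $\log^* n=\min\{i : \log^{(i)}n\le 2\}$. An $m$-defective $\chi$-coloring uses at most $\chi$ colors, and each vertex has at most $m$ neighbours of its own color; it is legal if $m=0$. A family of sets is $A$-cover-free if none of its sets is covered by at most $A$ others. Let $c$, $\Lambda_0$, $\Delta_0$ be natural-number constants and $0<\delta<1$. All procedures are invoked in parallel on disjoint induced subgraphs when the vertex set has been partitioned. **Linial's algorithm**, on a graph of maximum degree at most $D$, starts with the identity numbers as colors. In each step, a legal $m$-coloring becomes a legal $s$-coloring in one round, where $s$ is least such that $\{1,\dots,s\}$ has an $A$-cover-free family of $m$ subsets with $A=D$: each color is assigned its own subset, and a vertex selects an element of the subset of its color that lies in no subset of a color of a neighbour (*cover-free step*). This is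 repeated until $s\le cD^2$. **KW iterative procedure**, on a graph of maximum degree at most $\Lambda$ with a legal $m$-coloring: in each of $\lceil\log (m/(\Lambda+1))\rceil$ iterations the palette is split into blocks of $2(\Lambda+1)$ colors and, in parallel, in $\Lambda+1$ rounds, the vertices of the upper $\Lambda+1$ colors of a block move, one color per round, to free colors among its lower $\Lambda+1$ colors. The result is a legal $(\Lambda+1)$-coloring. **Procedure Refine** with parameter $p$, on a $\chi$-colored graph: a vertex selects $\psi(v)\in\{1,\dots,p\}$ as a color selected by the fewest of its neighbours of smaller color, once all these have selected theirs; in parallel it selects $\Psi(v)\in\{1,\dots,p\}$ in the same way with respect to its neighbours of larger color. After $\chi$ rounds its new color, out of $p^2$, is the pair $(\Psi(v),\psi(v))$. **Procedure Defective-Color** with parameters $p,q$, on a graph with a legal $\chi$-coloring: while $\chi>p^2$, split the palette into $h=\max\{\lfloor\chi/q\rfloor,1\}$ intervals of $q$ colors (the last one has at most $2q$, or $\chi$ if $\chi<q$), invoke Procedure Refine with parameter $p$ in parallel on the subgraphs of vertices with colors in the same interval, use disjoint palettes of size $p^2$ for the results, and set $\chi:=h\,p^2$. If the maximum degree is at most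 $\Lambda$, the defect of the result is at most $r\lfloor\Lambda/p\rfloor$, where $r$ is the number of iterations of the loop. **Procedure Delta-Color** at level $i$, on a graph of maximum degree at most $\Lambda$ with a legal $c\Lambda^2$-coloring $\psi$: if $i\le1$ or $\Lambda<\Lambda_0$, apply the KW iterative procedure to $\psi$. Otherwise let $k=\lfloor\log^{(i-1)}\Lambda\rfloor$, apply Procedure Defective-Color with $p=k$, $q=\lfloor\Lambda^{\delta}\rfloor$ to $\psi$, and let $d=r\lfloor\Lambda/k\rfloor$ be its defect bound. On each of the $k^2$ color classes, in parallel, turn $\psi$ into a legal $c\,d^2$-coloring by one cover-free step with $A=d$, and invoke Procedure Delta-Color at level $i-1$ with $d$ in the role of $\Lambda$. Combine the results with disjoint palettes of size $d+1$ and apply the KW iterative procedure to obtain a legal $(\Lambda+1)$-coloring. **Procedure Tradeoff-Delta-Color** with a real parameter $t$. * If $\Delta<\Delta_0$, apply Linial's algorithm and then Procedure Delta-Color at level $\log^*\Delta$ to $G$. * If $\Delta\ge\Delta_0$ and $t<\Delta^{1/4}$, compute a $c\Delta^2$-coloring $\lambda$ by Linial's algorithm, and apply Procedure Defective-Color to $\lambda$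 with $p=\lfloor t\rfloor$, $q=\lfloor\Delta^{3/4}\rfloor$. Let $D$ be its defect bound. On each of the $p^2$ color classes, in parallel, turn $\lambda$ into a legal $cD^2$-coloring by one cover-free step with $A=D$ and apply Procedure Delta-Color at level $\log^* D$ with degree bound $D$; use disjoint palettes of size $D+1$. * Otherwise let $p=\lfloor(\min\{t,\Delta/t\})^{1/3}\rfloor$, $q=\lfloor\min\{t,\Delta/t\}\rfloor$ and $L=\lfloor\log_p t\rfloor$. Perform $L$ iterations with parameters $(p,q)$ and one more with parameters $(\lfloor t/p^{L}\rfloor,q)$. In an iteration, Linial's algorithm and then Procedure Defective-Color are applied in parallel to all current classes (at first $V$ is the only one, with degree bound $\Delta$), each class is split into the color classes of the result, and the new degree bound is the defect bound. Finally, with $D$ the last degree bound, Linial's algorithm and Procedure Delta-Color at level $\log^* D$ with degree bound $D$ are applied in parallel to all classes, with disjoint palettes of size $D+1$. **Statement.** There is a constant $c$ such that for every $0<\delta<1$ there is $\Lambda_0$ (depending on $\delta$) such that for every $0<\varepsilon<1$ there are $\Delta_0$ and $I$ (depending on $\delta,\varepsilon$) such that for every $\kappa$ there is $C>0$ (depending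 on $\delta,\varepsilon,\kappa$) with the following property. For every finite graph $G$ with $n$ vertices and maximum degree $\Delta$, all distinct identity numbers in $\{0,\dots,n^\kappa\}$, and every real $t$ with $1<t\le\Delta^{1-\varepsilon}$, Procedure Tradeoff-Delta-Color computes a legal coloring of $G$ with at most $C\cdot\Delta\cdot t$ colors within $C\cdot(\Delta/t+\log^* n)$ rounds, and the number of its iterations of defective coloring is at most $I$. -/

import Mathlib

/-! Distributed colouring in the synchronous message passing model. Colours are numbered from `0`,
so an `m`-colouring uses colours from `{0, ..., m - 1}`. -/

namespace DistColor

/-! ### The message passing model -/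

/-- The program of a single vertex. `done a` has stopped with output `a`. `send m k` broadcasts the
message `m` to all neighbours, waits for the end of the round, and goes on as `k inbox`, where `inbox`
is the multiset of messages received in that round. Local computation is free. -/
inductive Protocol (M α : Type) : Type
  | done : α → Protocol M α
  | send : M → (Multiset M → Protocol M α) → Protocol M α

namespace Protocol

variable {M α β : Type}

/-- Sequential composition. -/
def bind : Protocol M α → (α → Protocol M β) → Protocol M β
  | done a, f => f a
  | send m k, f => send m (fun inbox => (k inbox).bind f)

instance : Monad (Protocol M) where
  pure := done
  bind := bind

/-- The message that a vertex broadcasts in the current round, if it has not stopped. -/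
def outgoing : Protocol M α → Option M
  | done _ => none
  | send m _ => some m

/-- What becomes of a vertex that receives `inbox` in the current round. -/
def advance : Protocol M α → Multiset M → Protocol M α
  | done a, _ => done a
  | send _ k, inbox => k inbox

end Protocol

section Network

variable {V : Type*} [Fintype V] {M α : Type}

/-- One synchronous round on the network `G`: `P v` is the current state of the vertex `v`. -/
def step (G : SimpleGraph V) [DecidableRel G.Adj] (P : V → Protocol M α) : V → Protocol M α :=
  fun v => (P v).advance ((G.neighborFinset v).val.filterMap fun u => (P u).outgoing)

/-- After at most `T` rounds on the network `G` all vertices have stopped, and `v` has output `out v`. -/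
def ComputesWithin (G : SimpleGraph V) [DecidableRel G.Adj] (P : V → Protocol M α) (T : ℕ)
    (out : V → α) : Prop :=
  ∀ v, (step G)^[T] P v = Protocol.done (out v)

end Network

/-! ### Iterated logarithms (base `2`) -/

/-- `log^{(i)} x`. -/
noncomputable def iterLog (i : ℕ) (x : ℝ) : ℝ := (Real.logb 2)^[i] x

/-- `log^* n = min {i | log^{(i)} n ≤ 2}`. -/
noncomputable def logStar (n : ℕ) : ℕ := sInf {i | iterLog i n ≤ 2}

/-! ### Communication inside vertex classes

All procedures below run in parallel on the disjoint subgraphs induced by the classes of a partition of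
the vertex set. Each vertex knows the label `cls : List ℕ` of its class, attaches it to every message, and
ignores the messages that come from other classes. -/

/-- The content of a message: a colour, and two colours that may not have been selected yet. -/
abbrev Content : Type := ℕ × Option ℕ × Option ℕ

/-- A message: the label of the class of the sender, and the content. -/
abbrev Msg : Type := List ℕ × Content

/-- One round: broadcast `x`, and collect what the neighbours in the same class broadcast. -/
def exchange (cls : List ℕ) (x : Content) : Protocol Msg (Multiset Content) :=
  Protocol.send (cls, x) fun inbox =>
    Protocol.done ((inbox.filter fun m => m.1 = cls).map fun m => m.2)

/-- One round: broadcast a colour, and collect the colours of the neighbours in the same class. -/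
def exchangeColor (cls : List ℕ) (col : ℕ) : Protocol Msg (Multiset ℕ) := do
  let inbox ← exchange cls (col, none, none)
  return inbox.map fun x => x.1

/-! ### Legal colourings with `O(A ^ 2)` colours -/

/-- `F 0, ..., F (m - 1)` are subsets of `{0, ..., s - 1}`, none of which is covered by the union of at
most `A` others. -/
def IsCoverFree (A m s : ℕ) (F : ℕ → Finset ℕ) : Prop :=
  (∀ x < m, F x ⊆ Finset.range s) ∧
    ∀ x < m, ∀ Y : Finset ℕ, Y ⊆ Finset.range m → x ∉ Y → Y.card ≤ A → ¬ F x ⊆ Y.biUnion F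

open Classical in
/-- A fixed family with `IsCoverFree A m s` (empty sets, if there is no such family). -/
noncomputable def coverFreeFamily (A m s : ℕ) : ℕ → Finset ℕ :=
  if h : ∃ F, IsCoverFree A m s F then h.choose else fun _ => ∅

/-- One round that turns a legal `m`-colouring of a graph of maximum degree at most `A` into a legal
`s`-colouring, by means of an `A`-cover-free family of `m` subsets of `{0, ..., s - 1}`: a vertex selects
an element of its own set that lies in none of the sets of its neighbours. -/
noncomputable def reduceColors (cls : List ℕ) (A m s col : ℕ) : Protocol Msg ℕ := do
  let nbrs ← exchangeColor cls col
  return sInf {a | a ∈ coverFreeFamily A m s col ∧ ∀ y ∈ nbrs, a ∉ coverFreeFamily A m s y}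

/-- The number of colours after `i` steps of Linial's algorithm, from `N` colours: in each step it is the
least size of a ground set on which there are enough sets for the current number of colours. -/
noncomputable def linialSize (A N : ℕ) : ℕ → ℕ
  | 0 => N
  | i + 1 => sInf {s | ∃ F, IsCoverFree A (linialSize A N i) s F}

/-- The number of steps after which Linial's algorithm has reached at most `c * A ^ 2` colours. -/
noncomputable def linialSteps (c A N : ℕ) : ℕ := sInf {i | linialSize A N i ≤ c * A ^ 2}

/-- The steps of Linial's algorithm from step `i` on, `r` steps remaining. -/
noncomputable def linialLoop (cls : List ℕ) (A N : ℕ) : (r i col : ℕ) → Protocol Msg ℕ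
  | 0, _, col => return col
  | r + 1, i, col => do
      let col ← reduceColors cls A (linialSize A N i) (linialSize A N (i + 1)) col
      linialLoop cls A N r (i + 1) col

/-- Linial's algorithm: computes a legal `c * A ^ 2`-colouring of a graph of maximum degree at most `A`
from distinct identity numbers `ident < N`. -/
noncomputable def linial (c : ℕ) (cls : List ℕ) (A N ident : ℕ) : Protocol Msg ℕ :=
  linialLoop cls A N (linialSteps c A N) 0 ident

/-! ### The Kuhn-Wattenhofer iterative procedure -/

/-- The rounds `s, s + 1, ...` (`r` of them) of one iteration inside one block of `2 * (Λ + 1)` colours: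
in round `s` the vertices of colour `Λ + 1 + s` move to a free colour in `{0, ..., Λ}`. -/
noncomputable def kwBlock (cls : List ℕ) (Λ : ℕ) : (r s col : ℕ) → Protocol Msg ℕ
  | 0, _, col => return col
  | r + 1, s, col => do
      let nbrs ← exchangeColor cls col
      kwBlock cls Λ r (s + 1) (if col = Λ + 1 + s then sInf {a | a ∉ nbrs} else col)

/-- `r` iterations, each of which splits the palette into blocks of `2 * (Λ + 1)` colours and, in parallel
for all blocks, replaces each block by `Λ + 1` colours in `Λ + 1` rounds. -/
noncomputable def kwLoop (cls : List ℕ) (Λ : ℕ) : (r col : ℕ) → Protocol Msg ℕ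
  | 0, col => return col
  | r + 1, col => do
      let b := col / (2 * (Λ + 1))
      let new ← kwBlock (b :: cls) Λ (Λ + 1) 0 (col % (2 * (Λ + 1)))
      kwLoop cls Λ r (b * (Λ + 1) + new)

/-- The KW iterative procedure: computes a legal `(Λ + 1)`-colouring of a graph of maximum degree at most
`Λ` from a legal `m`-colouring, in `(Λ + 1) * ⌈log (m / (Λ + 1))⌉` rounds. -/
noncomputable def kw (cls : List ℕ) (Λ m col : ℕ) : Protocol Msg ℕ :=
  kwLoop cls Λ (Nat.clog 2 (m ⌈/⌉ (Λ + 1))) col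

/-! ### Procedure Refine -/

/-- A colour of `{0, ..., p - 1}` that occurs the least number of times in `l`. -/
noncomputable def leastUsed (p : ℕ) (l : Multiset ℕ) : ℕ :=
  sInf {x | x < p ∧ ∀ y < p, l.count x ≤ l.count y}

/-- A vertex that has not selected a colour (`own = none`) selects a least used one as soon as all the
neighbours that it waits for, whose selections are `l`, have selected theirs. -/
noncomputable def select (p : ℕ) (own : Option ℕ) (l : Multiset (Option ℕ)) : Option ℕ :=
  if own.isSome then own else if none ∈ l then none else some (leastUsed p (l.filterMap id))

/-- `r` rounds of the two stages of Procedure Refine, executed in parallel: `ψ` is selected with respect to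
the neighbours of smaller colour, `Ψ` with respect to the neighbours of larger colour. -/
noncomputable def refineLoop (cls : List ℕ) (p φ : ℕ) :
    (r : ℕ) → (ψ Ψ : Option ℕ) → Protocol Msg ℕ
  | 0, ψ, Ψ => return Ψ.getD 0 * p + ψ.getD 0
  | r + 1, ψ, Ψ => do
      let inbox ← exchange cls (φ, ψ, Ψ)
      refineLoop cls p φ r
        (select p ψ ((inbox.filter fun x => x.1 < φ).map fun x => x.2.1))
        (select p Ψ ((inbox.filter fun x => φ < x.1).map fun x => x.2.2))

/-- Procedure Refine: turns an `m`-defective `χ`-colouring `φ` of a graph of maximum degree at most `Λ` into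
an `(m + ⌊Λ / p⌋)`-defective `p ^ 2`-colouring. -/
noncomputable def refineColoring (cls : List ℕ) (p χ φ : ℕ) : Protocol Msg ℕ :=
  refineLoop cls p φ χ none none

/-! ### Procedure Defective-Color -/

/-- The bound on the number of colours after an iteration that starts with at most `χ` colours. -/
def dcNext (p q χ : ℕ) : ℕ := max (χ / q) 1 * p ^ 2

/-- The number of iterations of the loop `while χ > p ^ 2`, when it starts with `χ` colours. -/
noncomputable def dcIters (p q χ : ℕ) : ℕ := sInf {i | (dcNext p q)^[i] χ ≤ p ^ 2}

/-- `r` iterations of the loop. A vertex of colour `φ` joins the set `V_j`, on which the colouring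
`φ - j * q` has at most `min χ (2 * q)` colours, and Procedure Refine is invoked on all sets `V_j` in
parallel. -/
noncomputable def dcLoop (cls : List ℕ) (p q : ℕ) : (r χ φ : ℕ) → Protocol Msg ℕ
  | 0, _, φ => return φ
  | r + 1, χ, φ => do
      let j := if χ < q then 0 else min (φ / q) (χ / q - 1)
      let new ← refineColoring (j :: cls) p (min χ (2 * q)) (φ - j * q)
      dcLoop cls p q r (dcNext p q χ) (new + j * p ^ 2)

/-- Procedure Defective-Color with the parameters `p` and `q`, from a legal `χ`-colouring `φ`. -/
noncomputable def defectiveColor (cls : List ℕ) (p q χ φ : ℕ) : Protocol Msg ℕ :=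
  dcLoop cls p q (dcIters p q χ) χ φ

/-- The defect that Procedure Defective-Color guarantees, on a graph of maximum degree at most `Λ`: each
of its iterations adds at most `⌊Λ / p⌋`. -/
noncomputable def dcDefect (p q χ Λ : ℕ) : ℕ := dcIters p q χ * (Λ / p)

/-! ### Procedure Delta-Color -/

/-- Procedure Delta-Color at recursion level `i`: computes a legal `(Λ + 1)`-colouring of a graph of
maximum degree at most `Λ` from a legal `c * Λ ^ 2`-colouring `ψ`. It invokes Procedure Defective-Color with
`p = ⌊log^{(i - 1)} Λ⌋` and `q = ⌊Λ ^ δ⌋`. Graphs of maximum degree below the constant `Λ₀` are coloured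
directly. -/
noncomputable def deltaColor (c Λ₀ : ℕ) (δ : ℝ) :
    (i : ℕ) → (cls : List ℕ) → (Λ ψ : ℕ) → Protocol Msg ℕ
  | 0, cls, Λ, ψ => kw cls Λ (c * Λ ^ 2) ψ
  | i + 1, cls, Λ, ψ =>
      if i = 0 ∨ Λ < Λ₀ then kw cls Λ (c * Λ ^ 2) ψ
      else do
        let k := ⌊iterLog i Λ⌋₊
        let q := ⌊(Λ : ℝ) ^ δ⌋₊
        let d := dcDefect k q (c * Λ ^ 2) Λ
        let j ← defectiveColor cls k q (c * Λ ^ 2) ψ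
        let φ ← reduceColors (j :: cls) d (c * Λ ^ 2) (c * d ^ 2) ψ
        let col ← deltaColor c Λ₀ δ i (j :: cls) d φ
        kw cls Λ (k ^ 2 * (d + 1)) (col + (d + 1) * j)

/-! ### Procedure Tradeoff-Delta-Color -/

/-- The parameter `p`, when `Δ ^ (1 / 4) ≤ t`. -/
noncomputable def tradeoffP (Δ : ℕ) (t : ℝ) : ℕ := ⌊(min t (Δ / t)) ^ (1 / 3 : ℝ)⌋₊

/-- The parameter `q`, when `Δ ^ (1 / 4) ≤ t`. -/
noncomputable def tradeoffQ (Δ : ℕ) (t : ℝ) : ℕ := ⌊min t (Δ / t)⌋₊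

/-- The number of iterations with the parameters `p` and `q`, when `Δ ^ (1 / 4) ≤ t`: `⌊log_p t⌋`. -/
noncomputable def tradeoffL (Δ : ℕ) (t : ℝ) : ℕ := ⌊Real.logb (tradeoffP Δ t) t⌋₊

/-- The parameters `(p, q)` of the successive invocations of Procedure Defective-Color, when
`Δ ^ (1 / 4) ≤ t`. -/
noncomputable def tradeoffSchedule (Δ : ℕ) (t : ℝ) : List (ℕ × ℕ) :=
  List.replicate (tradeoffL Δ t) (tradeoffP Δ t, tradeoffQ Δ t) ++
    [(⌊t / (tradeoffP Δ t : ℝ) ^ tradeoffL Δ t⌋₊, tradeoffQ Δ t)]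

/-- Processes a schedule. The current classes induce subgraphs of maximum degree at most `D`, and `idx` is
the number of the class of the vertex. For each `(p, q)`, Procedure Defective-Color is invoked on all
classes in parallel, and splits each of them into `p ^ 2` classes. In the end Procedure Delta-Color
is invoked on all classes in parallel, and disjoint palettes of size `D + 1` are used. -/
noncomputable def tradeoffLoop (c Λ₀ : ℕ) (δ : ℝ) (N ident : ℕ) :
    (sched : List (ℕ × ℕ)) → (cls : List ℕ) → (D idx : ℕ) → Protocol Msg ℕ
  | [], cls, D, idx => do
      let φ ← linial c cls D N ident
      let col ← deltaColor c Λ₀ δ (logStar D) cls D φ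
      return idx * (D + 1) + col
  | (p, q) :: sched, cls, D, idx => do
      let φ ← linial c cls D N ident
      let j ← defectiveColor cls p q (c * D ^ 2) φ
      tradeoffLoop c Λ₀ δ N ident sched (j :: cls) (dcDefect p q (c * D ^ 2) D) (idx * p ^ 2 + j)

/-- The case `t < Δ ^ (1 / 4)`: a single invocation of Procedure Defective-Color with `p = ⌊t⌋` and
`q = ⌊Δ ^ (3 / 4)⌋`, and then Procedure Delta-Color on all classes in parallel, from a colouring that is
obtained in one round from the initial colouring `lam`. -/
noncomputable def tradeoffSmall (c Λ₀ : ℕ) (δ : ℝ) (N Δ : ℕ) (t : ℝ) (ident : ℕ) : Protocol Msg ℕ := do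
  let p := ⌊t⌋₊
  let q := ⌊(Δ : ℝ) ^ (3 / 4 : ℝ)⌋₊
  let D := dcDefect p q (c * Δ ^ 2) Δ
  let lam ← linial c [] Δ N ident
  let j ← defectiveColor [] p q (c * Δ ^ 2) lam
  let φ ← reduceColors [j] D (c * Δ ^ 2) (c * D ^ 2) lam
  let col ← deltaColor c Λ₀ δ (logStar D) [j] D φ
  return j * (D + 1) + col

/-- Procedure Tradeoff-Delta-Color with the parameter `t`, at a vertex with identity number `ident < N` of a
graph of maximum degree `Δ`. Graphs of maximum degree below the constant `Δ₀` are coloured by Procedure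
Delta-Color at once. -/
noncomputable def tradeoffDeltaColor (c Λ₀ Δ₀ : ℕ) (δ : ℝ) (N Δ : ℕ) (t : ℝ) (ident : ℕ) :
    Protocol Msg ℕ :=
  if Δ < Δ₀ then tradeoffLoop c Λ₀ δ N ident [] [] Δ 0
  else if t < (Δ : ℝ) ^ (1 / 4 : ℝ) then tradeoffSmall c Λ₀ δ N Δ t ident
  else tradeoffLoop c Λ₀ δ N ident (tradeoffSchedule Δ t) [] Δ 0

/-- The number of successive stages in which Procedure Tradeoff-Delta-Color invokes Procedure
Defective-Color. -/
noncomputable def tradeoffIters (Δ₀ Δ : ℕ) (t : ℝ) : ℕ :=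
  if Δ < Δ₀ then 0
  else if t < (Δ : ℝ) ^ (1 / 4 : ℝ) then 1
  else (tradeoffSchedule Δ t).length

end DistColor

/-! The engine is Procedure Defective-Color with `p ^ 3 ≤ q` and `p ^ 2 < q`. Each iteration shrinks
the palette by a factor `p ^ 2 / q ≤ q ^ (-1/3)`, so a palette polynomial in `q` needs only a
constant number `r` of iterations (`dcIters_spec`). In `O(q)` rounds a class of degree `Λ` splits
into `p ^ 2` classes of degree at most `r * Λ / p`.

Linial's algorithm takes `O(log* n)` rounds: graphs of polynomials over a prime field form
cover-free families, so a step replaces `x` colors by about `(log x) ^ 4` until `O(A ^ 2)` is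
reached (`exists_linialSteps_le`).

Procedure Delta-Color takes `O(Λ)` rounds (`exists_deltaBound`). With `k` about `log^{(i-1)} Λ` the
subproblems have degree `d = O(Λ / k)`, and merging their `k ^ 2 * (d + 1)` colors by the KW
procedure costs `2 * Λ * (log k + O(1))`. The recursion keeps the bound `2 * Λ * (log^{(i)} Λ +
const)`. The constant does not grow with the number `log* Λ` of levels: the iterated logarithm that
governs `k` increases by at least one per recursive call, so after boundedly many calls the degree
drops by a factor 4 each time, which pays for all further additive errors. At level `log* Λ` the
logarithm is at most 2.

Procedure Tradeoff-Delta-Color chooses parameters whose product `pr` satisfies `t / 2 ≤ pr ≤ t`.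
This leaves at most `t ^ 2` classes of degree `O(Δ / t)`, hence `O(Δ * t)` colors and `O(Δ / t)`
rounds on top of a bounded number of Linial calls. The number of stages is bounded because `p` is at
least a fixed power of `Δ` (`tradeoffSchedule_spec`, `tradeoffLoop_spec`). -/

open Filter

namespace DistColor

/-! ### Synchronous executions and their sequential composition. -/

section Runs

variable {V : Type*} [Fintype V] {M α β : Type}

/-- All vertices send in each of `T` rounds, and then stop with the outputs `out`. -/
inductive Runs (G : SimpleGraph V) [DecidableRel G.Adj] :
    ℕ → (V → Protocol M α) → (V → α) → Prop
  | done (out : V → α) : Runs G 0 (fun v => Protocol.done (out v)) out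
  | send {T : ℕ} {m : V → M} {k : V → Multiset M → Protocol M α} {out : V → α} :
      Runs G T (fun v => k v ((G.neighborFinset v).val.map m)) out →
        Runs G (T + 1) (fun v => Protocol.send (m v) (k v)) out

variable {G : SimpleGraph V} [DecidableRel G.Adj]

theorem Runs.pure (out : V → α) :
    Runs G 0 (fun v => (Pure.pure (out v) : Protocol M α)) out :=
  Runs.done out

/-- Since all vertices leave the first phase in the same round, the second phase starts in lockstep
and the durations add exactly. This is why `Runs` asks for a common `T`, unlike `ComputesWithin`. -/
theorem Runs.bind {T T' S : ℕ} {P : V → Protocol M α} {out : V → α}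
    {f : V → α → Protocol M β} {out' : V → β} (h : Runs G T P out)
    (h' : Runs G T' (fun v => f v (out v)) out') (hS : T + T' = S) :
    Runs G S (fun v => P v >>= f v) out' := by
  subst hS
  induction h with
  | done out => rw [Nat.zero_add]; exact h'
  | send _ ih => rw [Nat.add_right_comm]; exact Runs.send (ih h')

theorem Runs.computesWithin {T : ℕ} {P : V → Protocol M α} {out : V → α} (h : Runs G T P out) :
    ComputesWithin G P T out := by
  induction h with
  | done out => intro v; rfl
  | send _ ih =>
    intro v
    rw [Function.iterate_succ_apply, ← ih v]
    refine congrArg (fun P => (step _)^[_] P v) (funext fun w => ?_)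
    simp only [step, Protocol.advance, Protocol.outgoing]
    congr 1
    exact congrFun (Multiset.filterMap_eq_map _) _

end Runs

/-! ### Legal and defective colorings relative to a partition into classes. -/

section Legal

variable {V : Type*}

/-- The colouring is legal on each class. -/
def Legal (G : SimpleGraph V) (cls : V → List ℕ) (col : V → ℕ) : Prop :=
  ∀ ⦃u v⦄, G.Adj u v → cls u = cls v → col u ≠ col v

theorem Legal.cons {G : SimpleGraph V} {cls : V → List ℕ} {col : V → ℕ} (h : Legal G cls col)
    (j : V → ℕ) :
    Legal G (fun v => j v :: cls v) col := fun _ _ huv hc =>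
  h huv (List.cons.inj hc).2

end Legal

section Classes

variable {V : Type*} [Fintype V] (G : SimpleGraph V) [DecidableRel G.Adj]

/-- The neighbours of a vertex that lie in its own class. -/
def classNbrs (cls : V → List ℕ) (v : V) : Finset V :=
  (G.neighborFinset v).filter fun u => cls u = cls v

/-- The classes induce subgraphs of maximum degree at most `Λ`. -/
def DegLe (cls : V → List ℕ) (Λ : ℕ) : Prop :=
  ∀ v, (classNbrs G cls v).card ≤ Λ

/-- The colouring is `m`-defective on each class. -/
def Defective (cls : V → List ℕ) (m : ℕ) (col : V → ℕ) : Prop :=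
  ∀ v, ((classNbrs G cls v).filter fun u => col u = col v).card ≤ m

variable {G} {cls : V → List ℕ}

theorem mem_classNbrs {u v : V} : u ∈ classNbrs G cls v ↔ G.Adj v u ∧ cls u = cls v := by
  simp [classNbrs]

theorem classNbrs_cons (j : V → ℕ) (v : V) :
    classNbrs G (fun v => j v :: cls v) v = (classNbrs G cls v).filter fun u => j u = j v := by
  ext u
  simp only [mem_classNbrs, Finset.mem_filter, List.cons.injEq]
  tauto

theorem DegLe.cons {Λ : ℕ} (h : DegLe G cls Λ) (j : V → ℕ) :
    DegLe G (fun v => j v :: cls v) Λ := fun v => by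
  rw [classNbrs_cons]
  exact (Finset.card_filter_le _ _).trans (h v)

theorem Defective.degLe_cons {m : ℕ} {j : V → ℕ} (h : Defective G cls m j) :
    DegLe G (fun v => j v :: cls v) m := fun v => by
  rw [classNbrs_cons]
  exact h v

theorem Legal.defective {col : V → ℕ} (h : Legal G cls col) : Defective G cls 0 col := fun v => by
  rw [Nat.le_zero, Finset.card_eq_zero, Finset.filter_eq_empty_iff]
  intro u hu
  rw [mem_classNbrs] at hu
  exact h hu.1.symm hu.2

/-! ### Communication inside classes, the cover-free step and Linial's algorithm. -/

theorem runs_exchange (cls : V → List ℕ) (x : V → Content) :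
    Runs G 1 (fun v => exchange (cls v) (x v)) (fun v => (classNbrs G cls v).val.map x) := by
  refine Runs.send (m := fun v => (cls v, x v)) ?_
  have : (fun v => (classNbrs G cls v).val.map x) = fun v =>
      ((((G.neighborFinset v).val.map fun v => (cls v, x v)).filter fun m => m.1 = cls v).map
        fun m => m.2) := by
    funext v
    rw [Multiset.filter_map, Multiset.map_map]
    rfl
  rw [this]
  exact Runs.done _

theorem runs_exchangeColor (cls : V → List ℕ) (col : V → ℕ) :
    Runs G 1 (fun v => exchangeColor (cls v) (col v))
      (fun v => (classNbrs G cls v).val.map col) := by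
  refine (runs_exchange cls fun v => (col v, none, none)).bind (T' := 0) ?_ rfl
  have : (fun v => (classNbrs G cls v).val.map col) = fun v =>
      ((classNbrs G cls v).val.map fun v => ((col v, none, none) : Content)).map fun x => x.1 := by
    funext v
    rw [Multiset.map_map]
    rfl
  rw [this]
  exact Runs.pure _

theorem reduceColors_spec {A m s : ℕ} {col : V → ℕ} (hdeg : DegLe G cls A)
    (hleg : Legal G cls col) (hcol : ∀ v, col v < m) (hF : ∃ F, IsCoverFree A m s F) :
    ∃ out : V → ℕ, Runs G 1 (fun v => reduceColors (cls v) A m s (col v)) out ∧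
      Legal G cls out ∧ ∀ v, out v < s := by
  classical
  have hcf : IsCoverFree A m s (coverFreeFamily A m s) := by
    unfold coverFreeFamily
    rw [dif_pos hF]
    exact hF.choose_spec
  refine ⟨_, (runs_exchangeColor cls col).bind (T' := 0) (Runs.pure _) rfl, ?_⟩
  have key : ∀ v, sInf {a | a ∈ coverFreeFamily A m s (col v) ∧
      ∀ y ∈ (classNbrs G cls v).val.map col, a ∉ coverFreeFamily A m s y} ∈
      {a | a ∈ coverFreeFamily A m s (col v) ∧
      ∀ y ∈ (classNbrs G cls v).val.map col, a ∉ coverFreeFamily A m s y} := by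
    intro v
    apply Nat.sInf_mem
    have h := hcf.2 (col v) (hcol v) ((classNbrs G cls v).image col) ?_ ?_
      (Finset.card_image_le.trans (hdeg v))
    · obtain ⟨a, ha, hn⟩ := Finset.not_subset.1 h
      refine ⟨a, ha, fun y hy hay => hn (Finset.mem_biUnion.2 ⟨y, ?_, hay⟩)⟩
      obtain ⟨u, hu, rfl⟩ := Multiset.mem_map.1 hy
      exact Finset.mem_image_of_mem _ hu
    · intro y hy
      obtain ⟨u, -, rfl⟩ := Finset.mem_image.1 hy
      exact Finset.mem_range.2 (hcol u)
    · intro hy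
      obtain ⟨u, hu, he⟩ := Finset.mem_image.1 hy
      rw [mem_classNbrs] at hu
      exact hleg hu.1.symm hu.2 he
  refine ⟨fun u v huv hc he => ?_, fun v => Finset.mem_range.1 (hcf.1 _ (hcol v) (key v).1)⟩
  refine (key v).2 (col u) ?_
    (Set.mem_of_eq_of_mem (s := ↑(coverFreeFamily A m s (col u))) he.symm (key u).1)
  exact Multiset.mem_map_of_mem _ (mem_classNbrs.2 ⟨huv.symm, hc⟩)

/-- Singletons are cover-free for every `A`; this makes the set whose infimum defines `linialSize`
nonempty. -/
theorem exists_isCoverFree_self (A m : ℕ) : ∃ F, IsCoverFree A m m F := by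
  refine ⟨fun x => {x}, fun x hx => by simpa using hx, fun x _ Y _ hxY _ hsub => hxY ?_⟩
  simpa using hsub

theorem exists_isCoverFree_linialSize (A N i : ℕ) :
    ∃ F, IsCoverFree A (linialSize A N i) (linialSize A N (i + 1)) F :=
  Nat.sInf_mem (s := {s | ∃ F, IsCoverFree A (linialSize A N i) s F})
    ⟨_, exists_isCoverFree_self A _⟩

theorem linialLoop_spec {A N : ℕ} (hdeg : DegLe G cls A) (r i : ℕ) (col : V → ℕ)
    (hleg : Legal G cls col) (hcol : ∀ v, col v < linialSize A N i) :
    ∃ out : V → ℕ, Runs G r (fun v => linialLoop (cls v) A N r i (col v)) out ∧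
      Legal G cls out ∧ ∀ v, out v < linialSize A N (i + r) := by
  induction r generalizing i col with
  | zero => exact ⟨col, Runs.pure _, hleg, hcol⟩
  | succ r ih =>
    obtain ⟨col', h1, h2, h3⟩ :=
      reduceColors_spec hdeg hleg hcol (exists_isCoverFree_linialSize A N i)
    obtain ⟨out, h4, h5, h6⟩ := ih (i + 1) col' h2 h3
    refine ⟨out, ?_, h5, fun v => by have := h6 v; rwa [Nat.add_right_comm] at this⟩
    exact h1.bind h4 (Nat.add_comm _ _)

theorem linial_spec {c A N : ℕ} {ident : V → ℕ} (hdeg : DegLe G cls A)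
    (hinj : Function.Injective ident) (hN : ∀ v, ident v < N)
    (hsteps : ∃ i, linialSize A N i ≤ c * A ^ 2) :
    ∃ out : V → ℕ, Runs G (linialSteps c A N) (fun v => linial c (cls v) A N (ident v)) out ∧
      Legal G cls out ∧ ∀ v, out v < c * A ^ 2 := by
  obtain ⟨out, h1, h2, h3⟩ := linialLoop_spec (N := N) hdeg (linialSteps c A N) 0 ident
    (fun u v huv _ he => huv.ne (hinj he)) hN
  refine ⟨out, h1, h2, fun v => (h3 v).trans_le ?_⟩
  rw [Nat.zero_add]
  exact Nat.sInf_mem (s := {i | linialSize A N i ≤ c * A ^ 2}) hsteps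

/-! ### The Kuhn-Wattenhofer procedure -/

/-- Before round `s` the colors `Λ + 1, ..., Λ + s` are already vacated. Vertices that move together
share a color, so they are not adjacent inside a class, and at most `Λ` neighbors cannot occupy all
of `{0, ..., Λ}`. -/
theorem kwBlock_spec {Λ : ℕ} (hdeg : DegLe G cls Λ) (r s : ℕ) (hrs : s + r = Λ + 1) (col : V → ℕ)
    (hleg : Legal G cls col)
    (hcol : ∀ v, col v < Λ + 1 ∨ Λ + 1 + s ≤ col v ∧ col v < 2 * (Λ + 1)) :
    ∃ out : V → ℕ, Runs G r (fun v => kwBlock (cls v) Λ r s (col v)) out ∧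
      Legal G cls out ∧ ∀ v, out v < Λ + 1 := by
  induction r generalizing s col with
  | zero => exact ⟨col, Runs.pure _, hleg, fun v => by have := hcol v; omega⟩
  | succ r ih =>
    set new : V → ℕ := fun v => if col v = Λ + 1 + s then
      sInf {a | a ∉ (classNbrs G cls v).val.map col} else col v with hnew
    have hfree : ∀ v, sInf {a | a ∉ (classNbrs G cls v).val.map col} < Λ + 1 ∧
        sInf {a | a ∉ (classNbrs G cls v).val.map col} ∉ (classNbrs G cls v).val.map col := by
      intro v
      have : ∃ a ∈ Finset.range (Λ + 1), a ∉ (classNbrs G cls v).image col := by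
        by_contra! hcon
        have := Finset.card_le_card (show Finset.range (Λ + 1) ⊆ _ from hcon)
        have := this.trans (Finset.card_image_le.trans (hdeg v))
        simp at this
      obtain ⟨a, ha, hna⟩ := this
      have hmem : a ∈ {a | a ∉ (classNbrs G cls v).val.map col} := by simpa using hna
      exact ⟨(Nat.sInf_le hmem).trans_lt (Finset.mem_range.1 ha), Nat.sInf_mem ⟨a, hmem⟩⟩
    have hmem : ∀ {u v}, G.Adj u v → cls u = cls v → col u ∈ (classNbrs G cls v).val.map col :=
      fun huv hc => Multiset.mem_map_of_mem _ (mem_classNbrs.2 ⟨huv.symm, hc⟩)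
    have hleg' : Legal G cls new := by
      intro u v huv hc he
      have hne := hleg huv hc
      simp only [hnew] at he
      split_ifs at he with h1 h2 h2
      · exact hne (h1.trans h2.symm)
      · exact (hfree u).2 (he ▸ hmem huv.symm hc.symm)
      · exact (hfree v).2 (he ▸ hmem huv hc)
      · exact hne he
    have hcol' : ∀ v, new v < Λ + 1 ∨ Λ + 1 + (s + 1) ≤ new v ∧ new v < 2 * (Λ + 1) := by
      intro v
      have h1 := hcol v
      have h2 := (hfree v).1
      simp only [hnew]
      split_ifs <;> omega
    obtain ⟨out, h1, h2, h3⟩ := ih (s + 1) (by omega) new hleg' hcol'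
    exact ⟨out, (runs_exchangeColor cls col).bind (f := fun v nbrs => kwBlock (cls v) Λ r (s + 1)
      (if col v = Λ + 1 + s then sInf {a | a ∉ nbrs} else col v)) h1 (Nat.add_comm _ _), h2, h3⟩

/-- Each iteration halves the palette. The block number joins the class label, so blocks do not
interact, and block `b` is mapped to the `b`-th interval of length `Λ + 1`. -/
theorem kwLoop_spec {Λ : ℕ} (hdeg : DegLe G cls Λ) (r : ℕ) (col : V → ℕ)
    (hleg : Legal G cls col) (hcol : ∀ v, col v < 2 ^ r * (Λ + 1)) :
    ∃ out : V → ℕ, Runs G (r * (Λ + 1)) (fun v => kwLoop (cls v) Λ r (col v)) out ∧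
      Legal G cls out ∧ ∀ v, out v < Λ + 1 := by
  induction r generalizing col with
  | zero =>
    refine ⟨col, ?_, hleg, by simpa using hcol⟩
    rw [Nat.zero_mul]
    exact Runs.pure _
  | succ r ih =>
    have hpos : 0 < 2 * (Λ + 1) := by positivity
    set b : V → ℕ := fun v => col v / (2 * (Λ + 1)) with hb
    obtain ⟨new, h1, h2, h3⟩ := kwBlock_spec (hdeg.cons b) (Λ + 1) 0 (by omega)
      (fun v => col v % (2 * (Λ + 1)))
      (fun u v huv hc he => hleg huv (List.cons.inj hc).2 (by
        rw [← Nat.div_add_mod (col u) (2 * (Λ + 1)), ← Nat.div_add_mod (col v) (2 * (Λ + 1)), 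
          show col u % (2 * (Λ + 1)) = _ from he]
        congr 2
        exact (List.cons.inj hc).1))
      (fun v => by have := Nat.mod_lt (col v) hpos; omega)
    obtain ⟨out, h4, h5, h6⟩ := ih (fun v => b v * (Λ + 1) + new v)
      (fun u v huv hc he => by
        have hbb : b u = b v := by
          have hu : (b u * (Λ + 1) + new u) / (Λ + 1) = b u := by
            rw [Nat.mul_comm, Nat.mul_add_div (by omega), Nat.div_eq_of_lt (h3 u), Nat.add_zero]
          have hv : (b v * (Λ + 1) + new v) / (Λ + 1) = b v := by
            rw [Nat.mul_comm, Nat.mul_add_div (by omega), Nat.div_eq_of_lt (h3 v), Nat.add_zero]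
          rw [← hu, ← hv]
          exact congrArg (· / (Λ + 1)) he
        refine h2 huv (by simp [hbb, hc]) ?_
        simp only [hbb] at he
        omega)
      (fun v => by
        have hbv : b v < 2 ^ r := by
          rw [hb, Nat.div_lt_iff_lt_mul hpos]
          calc col v < _ := hcol v
            _ = _ := by ring
        have := h3 v
        calc b v * (Λ + 1) + new v < (b v + 1) * (Λ + 1) := by linarith
          _ ≤ 2 ^ r * (Λ + 1) := Nat.mul_le_mul_right _ hbv)
    exact ⟨out, h1.bind h4 (by rw [Nat.succ_mul, Nat.add_comm]), h5, h6⟩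

/-- The number of rounds of the Kuhn-Wattenhofer procedure. -/
def kwTime (Λ m : ℕ) : ℕ := Nat.clog 2 (m ⌈/⌉ (Λ + 1)) * (Λ + 1)

theorem kw_spec {Λ m : ℕ} (hdeg : DegLe G cls Λ) (col : V → ℕ)
    (hleg : Legal G cls col) (hcol : ∀ v, col v < m) :
    ∃ out : V → ℕ, Runs G (kwTime Λ m) (fun v => kw (cls v) Λ m (col v)) out ∧
      Legal G cls out ∧ ∀ v, out v < Λ + 1 := by
  refine kwLoop_spec hdeg _ col hleg fun v => (hcol v).trans_le ?_
  have h1 : m ≤ (Λ + 1) * (m ⌈/⌉ (Λ + 1)) := by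
    simpa using le_smul_ceilDiv (a := Λ + 1) (b := m) (Nat.succ_pos Λ)
  calc m ≤ (Λ + 1) * (m ⌈/⌉ (Λ + 1)) := h1
    _ ≤ (Λ + 1) * 2 ^ Nat.clog 2 (m ⌈/⌉ (Λ + 1)) :=
      Nat.mul_le_mul_left _ (Nat.le_pow_clog (by norm_num) _)
    _ = _ := Nat.mul_comm _ _

end Classes

/-! ### Procedure Refine -/

theorem leastUsed_spec {p : ℕ} (hp : 0 < p) (l : Multiset ℕ) :
    leastUsed p l < p ∧ ∀ y < p, l.count (leastUsed p l) ≤ l.count y := by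
  obtain ⟨x, hx, hmin⟩ := (Finset.range p).exists_min_image (fun x => l.count x)
    ⟨0, Finset.mem_range.2 hp⟩
  exact Nat.sInf_mem (s := {x | x < p ∧ ∀ y < p, l.count x ≤ l.count y})
    ⟨x, Finset.mem_range.1 hx, fun y hy => hmin y (Finset.mem_range.2 hy)⟩

/-- Averaging: the smallest of `p` multiplicities is at most the mean. -/
theorem mul_count_leastUsed_le {p : ℕ} (hp : 0 < p) (l : Multiset ℕ) :
    p * l.count (leastUsed p l) ≤ l.card := by
  calc p * l.count (leastUsed p l) = ∑ _y ∈ Finset.range p, l.count (leastUsed p l) := by simp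
    _ ≤ ∑ y ∈ Finset.range p, l.count y :=
      Finset.sum_le_sum fun y hy => (leastUsed_spec hp l).2 y (Finset.mem_range.1 hy)
    _ ≤ ∑ y ∈ Finset.range p ∪ l.toFinset, l.count y :=
      Finset.sum_le_sum_of_subset Finset.subset_union_left
    _ = l.card := Multiset.sum_count_eq_card fun a ha =>
      Finset.mem_union_right _ (Multiset.mem_toFinset.2 ha)

theorem count_filterMap_id (a : ℕ) (l : Multiset (Option ℕ)) :
    (l.filterMap id).count a = l.count (some a) := by
  induction l using Multiset.induction with
  | empty => simp
  | cons x l ih =>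
    cases x with
    | none => rw [Multiset.filterMap_cons_none _ _ rfl, ih]; simp
    | some b =>
      rw [Multiset.filterMap_cons_some id _ _ (b := b) rfl, Multiset.count_cons,
        Multiset.count_cons, ih]
      simp

theorem card_filterMap_id_le (l : Multiset (Option ℕ)) : (l.filterMap id).card ≤ l.card := by
  induction l using Multiset.induction with
  | empty => simp
  | cons x l ih =>
    cases x with
    | none => rw [Multiset.filterMap_cons_none _ _ rfl, Multiset.card_cons]; omega
    | some b =>
      rw [Multiset.filterMap_cons_some id _ _ (b := b) rfl, Multiset.card_cons,
        Multiset.card_cons]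
      omega

section Select

variable {V : Type*}

/-- Every vertex `v` that has made its selection has waited for those in `W v`, and has made a
selection that is least used among them. -/
def Selected (W : V → Finset V) (p : ℕ) (ψ : V → Option ℕ) : Prop :=
  ∀ v a, ψ v = some a → a < p ∧ (∀ u ∈ W v, ψ u ≠ none) ∧
    p * ((W v).filter fun u => ψ u = some a).card ≤ (W v).card

/-- A selection is never revised. A vertex that has selected sees only final selections in `W v`, so
its count stays frozen; for a fresh selection the count is bounded by averaging. -/
theorem Selected.next {W : V → Finset V} {p : ℕ} (hp : 0 < p) {ψ : V → Option ℕ}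
    (h : Selected W p ψ) : Selected W p fun v => select p (ψ v) ((W v).val.map ψ) := by
  have hext : ∀ u a, ψ u = some a → select p (ψ u) ((W u).val.map ψ) = some a := by
    intro u a hu
    simp [select, hu]
  have main : ∀ v a, (∀ u ∈ W v, ψ u ≠ none) →
      p * ((W v).filter fun u => ψ u = some a).card ≤ (W v).card →
      (∀ u ∈ W v, select p (ψ u) ((W u).val.map ψ) ≠ none) ∧
      p * ((W v).filter fun u => select p (ψ u) ((W u).val.map ψ) = some a).card
        ≤ (W v).card := by
    intro v a hW hcard
    have heq : ∀ u ∈ W v, select p (ψ u) ((W u).val.map ψ) = ψ u := by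
      intro u hu
      obtain ⟨b, hb⟩ := Option.ne_none_iff_exists'.1 (hW u hu)
      rw [hext u b hb, hb]
    refine ⟨fun u hu => by rw [heq u hu]; exact hW u hu, ?_⟩
    rwa [Finset.filter_congr fun u hu => by rw [heq u hu]]
  intro v a hv
  cases hψ : ψ v with
  | some b =>
    have hba : b = a := Option.some.inj ((hext v b hψ).symm.trans hv)
    subst hba
    obtain ⟨h1, h2, h3⟩ := h v b hψ
    exact ⟨h1, main v b h2 h3⟩
  | none =>
    have hnone : none ∉ (W v).val.map ψ := by
      intro hmem
      simp [select, hψ, hmem] at hv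
    have hW : ∀ u ∈ W v, ψ u ≠ none := fun u hu he =>
      hnone (Multiset.mem_map.2 ⟨u, hu, he⟩)
    have hleast : leastUsed p (((W v).val.map ψ).filterMap id) = a := by
      have : select p (ψ v) ((W v).val.map ψ) =
          some (leastUsed p (((W v).val.map ψ).filterMap id)) := by
        unfold select
        rw [if_neg (by simp [hψ]), if_neg hnone]
      exact Option.some.inj (this.symm.trans hv)
    refine ⟨hleast ▸ (leastUsed_spec hp _).1, main v a hW ?_⟩
    have h1 := mul_count_leastUsed_le hp (((W v).val.map ψ).filterMap id)
    rw [hleast, count_filterMap_id] at h1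
    have h2 := h1.trans (card_filterMap_id_le _)
    rw [Multiset.card_map, Multiset.count_map] at h2
    simpa only [Finset.card_def, Finset.filter_val, eq_comm] using h2

/-- Progress: `ρ` ranks the waiting relation, and every round completes one more rank. -/
theorem select_ne_none {W : V → Finset V} {ρ : V → ℕ} (hρ : ∀ v, ∀ u ∈ W v, ρ u < ρ v)
    {p s : ℕ} {ψ : V → Option ℕ} (h : ∀ v, ρ v < s → ψ v ≠ none) (v : V) (hv : ρ v < s + 1) :
    select p (ψ v) ((W v).val.map ψ) ≠ none := by
  have hnone : none ∉ (W v).val.map ψ := by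
    intro hmem
    obtain ⟨u, hu, he⟩ := Multiset.mem_map.1 hmem
    exact h u (by have := hρ v u hu; omega) he
  unfold select
  rw [if_neg hnone]
  cases ψ v <;> simp

end Select

section Refine

variable {V : Type*} [Fintype V] {G : SimpleGraph V} [DecidableRel G.Adj] {cls : V → List ℕ}

/-- The ranks are `φ` for the selection of `ψ` and `χ - 1 - φ` for that of `Ψ`. All ranks below `s`
are done after `s` rounds, so both stages end after `χ` rounds. -/
theorem refineLoop_spec {p χ : ℕ} (hp : 0 < p) {φ : V → ℕ} {W₁ W₂ : V → Finset V}
    (hφ : ∀ v, φ v < χ)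
    (hW₁ : ∀ v, W₁ v = (classNbrs G cls v).filter fun u => φ u < φ v)
    (hW₂ : ∀ v, W₂ v = (classNbrs G cls v).filter fun u => φ v < φ u)
    (r s : ℕ) (hrs : s + r = χ) (ψ Ψ : V → Option ℕ)
    (h₁ : Selected W₁ p ψ) (h₂ : Selected W₂ p Ψ)
    (hs₁ : ∀ v, φ v < s → ψ v ≠ none) (hs₂ : ∀ v, χ - 1 - φ v < s → Ψ v ≠ none) :
    ∃ a b : V → ℕ,
      Runs G r (fun v => refineLoop (cls v) p (φ v) r (ψ v) (Ψ v)) (fun v => b v * p + a v) ∧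
      Selected W₁ p (fun v => some (a v)) ∧ Selected W₂ p (fun v => some (b v)) := by
  induction r generalizing s ψ Ψ with
  | zero =>
    have ha : ∀ v, ∃ a, ψ v = some a := fun v =>
      Option.ne_none_iff_exists'.1 (hs₁ v (by have := hφ v; omega))
    have hb : ∀ v, ∃ b, Ψ v = some b := fun v =>
      Option.ne_none_iff_exists'.1 (hs₂ v (by have := hφ v; omega))
    choose a ha using ha
    choose b hb using hb
    obtain rfl : ψ = fun v => some (a v) := funext ha
    obtain rfl : Ψ = fun v => some (b v) := funext hb
    exact ⟨a, b, Runs.pure _, h₁, h₂⟩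
  | succ r ih =>
    have e₁ : ∀ v, (((classNbrs G cls v).val.map fun u => ((φ u, ψ u, Ψ u) : Content)).filter
        fun x => x.1 < φ v).map (fun x => x.2.1) = (W₁ v).val.map ψ := by
      intro v
      rw [hW₁, Multiset.filter_map, Multiset.map_map]
      rfl
    have e₂ : ∀ v, (((classNbrs G cls v).val.map fun u => ((φ u, ψ u, Ψ u) : Content)).filter
        fun x => φ v < x.1).map (fun x => x.2.2) = (W₂ v).val.map Ψ := by
      intro v
      rw [hW₂, Multiset.filter_map, Multiset.map_map]
      rfl
    obtain ⟨a, b, h3, h4⟩ := ih (s + 1) (by omega) _ _ (h₁.next hp) (h₂.next hp)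
      (fun v hv => select_ne_none (ρ := φ) (fun v u hu => by
        rw [hW₁] at hu; exact (Finset.mem_filter.1 hu).2) hs₁ v hv)
      (fun v hv => select_ne_none (ρ := fun v => χ - 1 - φ v) (fun v u hu => by
        rw [hW₂] at hu
        have h1 := (Finset.mem_filter.1 hu).2
        have h2 := hφ u
        show χ - 1 - φ u < χ - 1 - φ v
        omega) hs₂ v hv)
    refine ⟨a, b, ?_, h4⟩
    simp only [← e₁, ← e₂] at h3
    exact (runs_exchange cls _).bind (f := fun v inbox => refineLoop (cls v) p (φ v) r
        (select p (ψ v) ((inbox.filter fun x => x.1 < φ v).map fun x => x.2.1))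
        (select p (Ψ v) ((inbox.filter fun x => φ v < x.1).map fun x => x.2.2)))
        h3 (Nat.add_comm _ _)

/-- A neighbor with the same new pair has the same old color (at most `m` of these), or a smaller
one and the same `ψ`, or a larger one and the same `Ψ`. The last two groups are at most a `1 / p`
fraction of disjoint sets of neighbors with total size at most `Λ`. -/
theorem refineColoring_spec {p χ Λ m : ℕ} (hp : 0 < p) {φ : V → ℕ} (hdeg : DegLe G cls Λ)
    (hdef : Defective G cls m φ) (hφ : ∀ v, φ v < χ) :
    ∃ out : V → ℕ, Runs G χ (fun v => refineColoring (cls v) p χ (φ v)) out ∧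
      Defective G cls (m + Λ / p) out ∧ ∀ v, out v < p ^ 2 := by
  classical
  obtain ⟨a, b, h1, h2, h3⟩ := refineLoop_spec (cls := cls) (G := G) hp hφ (fun v => rfl)
    (fun v => rfl) χ 0 (Nat.zero_add _) (fun _ => none) (fun _ => none)
    (fun v a h => by simp at h) (fun v a h => by simp at h) (by simp) (by simp)
  refine ⟨_, h1, fun v => ?_, fun v => ?_⟩
  · have ha : ∀ v, a v < p := fun v => (h2 v _ rfl).1
    have hsub : ((classNbrs G cls v).filter fun u => b u * p + a u = b v * p + a v) ⊆
        ((classNbrs G cls v).filter fun u => φ u = φ v) ∪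
        ((((classNbrs G cls v).filter fun u => φ u < φ v).filter
            fun u => some (a u) = some (a v)) ∪
          (((classNbrs G cls v).filter fun u => φ v < φ u).filter
            fun u => some (b u) = some (b v))) := by
      intro u hu
      obtain ⟨hu, he⟩ := Finset.mem_filter.1 hu
      have hau : a u = a v := by
        have := congrArg (· % p) he
        simpa [Nat.mod_eq_of_lt (ha _)] using this
      have hbu : b u = b v := Nat.eq_of_mul_eq_mul_right hp (by omega)
      simp only [Finset.mem_union, Finset.mem_filter, hu, hau, hbu, and_true, true_and]
      omega
    have hx := (h2 v _ rfl).2.2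
    have hy := (h3 v _ rfl).2.2
    have hxy : ((classNbrs G cls v).filter fun u => φ u < φ v).card +
        ((classNbrs G cls v).filter fun u => φ v < φ u).card ≤ Λ := by
      rw [← Finset.card_union_of_disjoint]
      · exact (Finset.card_le_card (Finset.union_subset (Finset.filter_subset _ _)
          (Finset.filter_subset _ _))).trans (hdeg v)
      · exact Finset.disjoint_filter.2 fun u _ h => by omega
    refine (Finset.card_le_card hsub).trans ((Finset.card_union_le _ _).trans
      (add_le_add (hdef v) ((Finset.card_union_le _ _).trans ?_)))
    rw [Nat.le_div_iff_mul_le hp]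
    nlinarith
  · have ha := (h2 v _ rfl).1
    have hb := (h3 v _ rfl).1
    nlinarith

/-! ### Procedure Defective-Color -/

/-- Shifting by `j * q` preserves the defect inside an interval, and different intervals receive
disjoint palettes, so each iteration only adds the `Λ / p` of Procedure Refine. -/
theorem dcLoop_spec {p q Λ : ℕ} (hp : 0 < p) (hq : 0 < q) (hdeg : DegLe G cls Λ) (r χ m : ℕ)
    (φ : V → ℕ) (hdef : Defective G cls m φ) (hφ : ∀ v, φ v < χ) :
    ∃ (T : ℕ) (out : V → ℕ), T ≤ r * (2 * q) ∧
      Runs G T (fun v => dcLoop (cls v) p q r χ (φ v)) out ∧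
      Defective G cls (m + r * (Λ / p)) out ∧ ∀ v, out v < (dcNext p q)^[r] χ := by
  induction r generalizing χ m φ with
  | zero => exact ⟨0, φ, Nat.zero_le _, Runs.pure _, by simpa using hdef, hφ⟩
  | succ r ih =>
    set j : V → ℕ := fun v => if χ < q then 0 else min (φ v / q) (χ / q - 1) with hj
    have hjq : ∀ v, j v * q ≤ φ v := by
      intro v
      simp only [hj]
      split_ifs
      · simp
      · exact (Nat.mul_le_mul_right _ (min_le_left _ _)).trans (Nat.div_mul_le_self _ _)
    have hlt : ∀ v, φ v - j v * q < min χ (2 * q) := by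
      intro v
      refine lt_min ((Nat.sub_le _ _).trans_lt (hφ v)) ?_
      have h1 := hφ v
      simp only [hj]
      split_ifs with h
      · omega
      · rcases le_total (φ v / q) (χ / q - 1) with hle | hle
        · rw [min_eq_left hle]
          have h2 := Nat.div_add_mod (φ v) q
          have h3 := Nat.mod_lt (φ v) hq
          rw [Nat.mul_comm] at h2
          omega
        -- The last interval also absorbs the remainder of `χ` modulo `q`, hence the bound `2 * q`.
        · rw [min_eq_right hle, Nat.sub_mul, Nat.one_mul]
          have h2 := Nat.div_add_mod χ q
          have h3 := Nat.mod_lt χ hq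
          rw [Nat.mul_comm] at h2
          omega
    have hjh : ∀ v, j v < max (χ / q) 1 := by
      intro v
      simp only [hj]
      split_ifs with h
      · simp
      · have : 1 ≤ χ / q := (Nat.one_le_div_iff hq).2 (by omega)
        exact (min_le_right _ _).trans_lt (by omega)
    have hdef' : Defective G (fun v => j v :: cls v) m (fun v => φ v - j v * q) := by
      intro v
      refine (Finset.card_le_card fun u hu => ?_).trans (hdef v)
      rw [classNbrs_cons, Finset.mem_filter, Finset.mem_filter] at hu
      obtain ⟨⟨hu, hju⟩, he⟩ := hu
      refine Finset.mem_filter.2 ⟨hu, ?_⟩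
      have h1 := hjq u
      have h2 := hjq v
      replace he : φ u - j u * q = φ v - j v * q := he
      rw [hju] at he h1
      omega
    obtain ⟨new, h1, h2, h3⟩ := refineColoring_spec hp (hdeg.cons j) hdef' hlt
    obtain ⟨T, out, h4, h5, h6, h7⟩ := ih (dcNext p q χ) (m + Λ / p)
      (fun v => new v + j v * p ^ 2)
      (fun v => by
        refine (Finset.card_le_card fun u hu => ?_).trans (h2 v)
        rw [Finset.mem_filter] at hu
        obtain ⟨hu, he⟩ := hu
        have hpos : 0 < p ^ 2 := by positivity
        replace he : new u + j u * p ^ 2 = new v + j v * p ^ 2 := he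
        have hnew : new u = new v := by
          have := congrArg (· % p ^ 2) he
          simpa [Nat.mod_eq_of_lt (h3 _)] using this
        have hju : j u = j v := Nat.eq_of_mul_eq_mul_right hpos (by omega)
        rw [classNbrs_cons, Finset.mem_filter, Finset.mem_filter]
        exact ⟨⟨hu, hju⟩, hnew⟩)
      (fun v => by
        have ha := h3 v
        have hb : (j v + 1) * p ^ 2 ≤ dcNext p q χ := Nat.mul_le_mul_right _ (hjh v)
        rw [Nat.succ_mul] at hb
        show new v + j v * p ^ 2 < _
        omega)
    refine ⟨min χ (2 * q) + T, out, ?_, h1.bind h5 rfl, ?_, h7⟩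
    · rw [Nat.add_comm, Nat.add_one_mul r]
      exact add_le_add h4 (min_le_right _ _)
    · rwa [Nat.succ_mul, Nat.add_comm (r * _), ← Nat.add_assoc]

theorem defectiveColor_spec {p q χ Λ : ℕ} (hp : 0 < p) (hq : 0 < q) (hdeg : DegLe G cls Λ)
    {φ : V → ℕ} (hleg : Legal G cls φ) (hφ : ∀ v, φ v < χ)
    (hit : (dcNext p q)^[dcIters p q χ] χ ≤ p ^ 2) :
    ∃ (T : ℕ) (out : V → ℕ), T ≤ dcIters p q χ * (2 * q) ∧
      Runs G T (fun v => defectiveColor (cls v) p q χ (φ v)) out ∧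
      DegLe G (fun v => out v :: cls v) (dcDefect p q χ Λ) ∧ ∀ v, out v < p ^ 2 := by
  obtain ⟨T, out, h1, h2, h3, h4⟩ :=
    dcLoop_spec hp hq hdeg (dcIters p q χ) χ 0 φ hleg.defective hφ
  rw [Nat.zero_add] at h3
  exact ⟨T, out, h1, h2, h3.degLe_cons, fun v => (h4 v).trans_le hit⟩

/-! ### Procedure Delta-Color -/

/-- `T` rounds are enough for Procedure Delta-Color at level `i` with degree bound `Λ`, and its
parameters are admissible on all levels of the recursion. -/
inductive DeltaBound (c Λ₀ : ℕ) (δ : ℝ) : ℕ → ℕ → ℕ → Prop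
  | base {i Λ : ℕ} (h : i ≤ 1 ∨ Λ < Λ₀) : DeltaBound c Λ₀ δ i Λ (kwTime Λ (c * Λ ^ 2))
  | step {i Λ k q d T : ℕ} (hi : i ≠ 0) (hΛ : Λ₀ ≤ Λ) (hk : k = ⌊iterLog i Λ⌋₊)
      (hq : q = ⌊(Λ : ℝ) ^ δ⌋₊) (hd : d = dcDefect k q (c * Λ ^ 2) Λ) (hk0 : 0 < k) (hq0 : 0 < q)
      (hit : (dcNext k q)^[dcIters k q (c * Λ ^ 2)] (c * Λ ^ 2) ≤ k ^ 2)
      (hF : ∃ F, IsCoverFree d (c * Λ ^ 2) (c * d ^ 2) F) (h : DeltaBound c Λ₀ δ i d T) :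
      DeltaBound c Λ₀ δ (i + 1) Λ
        (dcIters k q (c * Λ ^ 2) * (2 * q) + (1 + (T + kwTime Λ (k ^ 2 * (d + 1)))))

theorem add_mul_lt_mul {a b m n : ℕ} (ha : a < m) (hb : b < n) : a + m * b < n * m := by
  calc a + m * b < m + m * b := by omega
    _ = (b + 1) * m := by ring
    _ ≤ n * m := Nat.mul_le_mul_right _ hb

theorem eq_and_eq_of_add_mul_eq {a a' b b' m : ℕ} (ha : a < m) (ha' : a' < m)
    (h : a + m * b = a' + m * b') : a = a' ∧ b = b' := by
  have h1 : a = a' := by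
    have := congrArg (· % m) h
    simpa [Nat.mod_eq_of_lt, ha, ha'] using this
  exact ⟨h1, Nat.eq_of_mul_eq_mul_left (by omega : 0 < m) (by omega)⟩

/-- The original `ψ` stays legal on the subclasses, so one cover-free step prepares it for the
recursive call. Equal merged colors mean equal `j` and equal `col`, which the recursive call
excludes for adjacent vertices of one class. -/
theorem deltaColor_spec {c Λ₀ : ℕ} {δ : ℝ} {i Λ T : ℕ} (h : DeltaBound c Λ₀ δ i Λ T)
    {cls : V → List ℕ} {ψ : V → ℕ} (hdeg : DegLe G cls Λ) (hleg : Legal G cls ψ)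
    (hψ : ∀ v, ψ v < c * Λ ^ 2) :
    ∃ (T' : ℕ) (out : V → ℕ), T' ≤ T ∧ Runs G T' (fun v => deltaColor c Λ₀ δ i (cls v) Λ (ψ v)) out ∧
      Legal G cls out ∧ ∀ v, out v < Λ + 1 := by
  induction h generalizing cls ψ with
  | @base i Λ h =>
    obtain ⟨out, h1, h2⟩ := kw_spec hdeg ψ hleg hψ
    refine ⟨_, out, le_rfl, ?_, h2⟩
    cases i with
    | zero => exact h1
    | succ i =>
      have hcond : i = 0 ∨ Λ < Λ₀ := by omega
      simp only [deltaColor, if_pos hcond]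
      exact h1
  | @step i Λ k q d T hi hΛ hk hq hd hk0 hq0 hit hF h ih =>
    obtain ⟨T₁, j, a1, a2, a3, a4⟩ := defectiveColor_spec hk0 hq0 hdeg hleg hψ hit
    rw [← hd] at a3
    obtain ⟨φ, b1, b2, b3⟩ := reduceColors_spec a3 (hleg.cons j) hψ hF
    obtain ⟨T₂, col, c1, c2, c3, c4⟩ := ih a3 b2 b3
    obtain ⟨out, d1, d2⟩ := kw_spec (m := k ^ 2 * (d + 1)) hdeg (fun v => col v + (d + 1) * j v)
      (fun u v huv hc he => by
        obtain ⟨h1, h2⟩ := eq_and_eq_of_add_mul_eq (c4 u) (c4 v) he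
        exact c3 huv (congrArg₂ List.cons h2 hc) h1)
      (fun v => add_mul_lt_mul (c4 v) (a4 v))
    refine ⟨T₁ + (1 + (T₂ + kwTime Λ (k ^ 2 * (d + 1)))), out, by omega, ?_, d2⟩
    have hcond : ¬ (i = 0 ∨ Λ < Λ₀) := by omega
    simp only [deltaColor, if_neg hcond]
    rw [← hk, ← hq, ← hd]
    exact a2.bind (b1.bind (c2.bind d1 rfl) rfl) rfl

end Refine

/-! ### Cover-free families from polynomials over prime fields -/

theorem IsCoverFree.mono {A m m' s : ℕ} {F : ℕ → Finset ℕ} (h : IsCoverFree A m s F)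
    (hm : m' ≤ m) : IsCoverFree A m' s F :=
  ⟨fun x hx => h.1 x (hx.trans_le hm), fun x hx Y hY => h.2 x (hx.trans_le hm) Y
    (hY.trans (Finset.range_mono hm))⟩

theorem IsCoverFree.mono_ground {A m s s' : ℕ} {F : ℕ → Finset ℕ} (h : IsCoverFree A m s F)
    (hs : s ≤ s') : IsCoverFree A m s' F :=
  ⟨fun x hx => (h.1 x hx).trans (Finset.range_mono hs), h.2⟩

/-- The sets are the graphs of the `q ^ (d + 1)` polynomials of degree at most `d` over the field
with `q` elements. Two of them share at most `d` points, so `A` others cover at most `A * d < q` of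
the `q` points of a graph. -/
theorem exists_isCoverFree_of_prime {A d q : ℕ} (hq : q.Prime) (hAd : A * d < q) :
    ∃ F, IsCoverFree A (q ^ (d + 1)) (q ^ 2) F := by
  classical
  have : Fact q.Prime := ⟨hq⟩
  have hcard : Fintype.card (Fin (d + 1) → ZMod q) = q ^ (d + 1) := by simp [ZMod.card]
  let e : (Fin (d + 1) → ZMod q) ≃ Fin (q ^ (d + 1)) := Fintype.equivFinOfCardEq hcard
  let P : ℕ → Polynomial (ZMod q) := fun x =>
    if hx : x < q ^ (d + 1) then ∑ i, Polynomial.C (e.symm ⟨x, hx⟩ i) * Polynomial.X ^ (i : ℕ)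
    else 0
  have hdeg : ∀ x, (P x).natDegree ≤ d := by
    intro x
    simp only [P]
    split_ifs
    · refine Polynomial.natDegree_sum_le_of_forall_le _ _ fun i _ => ?_
      exact (Polynomial.natDegree_C_mul_X_pow_le _ _).trans (by omega)
    · simp
  have hinj : ∀ x y, x < q ^ (d + 1) → y < q ^ (d + 1) → P x = P y → x = y := by
    intro x y hx hy he
    have : e.symm ⟨x, hx⟩ = e.symm ⟨y, hy⟩ := by
      funext i
      have h := congrArg (fun p => p.coeff (i : ℕ)) he
      simpa [P, hx, hy, Polynomial.finsetSum_coeff, Polynomial.coeff_C_mul,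
        Polynomial.coeff_X_pow, Fin.val_inj] using h
    simpa using this
  let pt : ℕ → ZMod q → ℕ := fun x a => ((P x).eval a).val + q * a.val
  have hpt : ∀ x y a b, pt x a = pt y b → a = b ∧ (P x).eval a = (P y).eval b := by
    intro x y a b h
    obtain ⟨h1, h2⟩ := eq_and_eq_of_add_mul_eq (ZMod.val_lt _) (ZMod.val_lt _) h
    exact ⟨ZMod.val_injective q h2, ZMod.val_injective q h1⟩
  refine ⟨fun x => Finset.univ.image (pt x), fun x _ y hy => ?_, fun x hx Y hY hxY hcY hsub => ?_⟩
  · obtain ⟨a, -, rfl⟩ := Finset.mem_image.1 hy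
    rw [Finset.mem_range, pow_two]
    exact add_mul_lt_mul (ZMod.val_lt _) (ZMod.val_lt _)
  · have hcover : (Finset.univ : Finset (ZMod q)) ⊆ Y.biUnion fun y => (P x - P y).roots.toFinset := by
      intro a _
      obtain ⟨y, hy, hay⟩ := Finset.mem_biUnion.1 (hsub (Finset.mem_image_of_mem (pt x)
        (Finset.mem_univ a)))
      obtain ⟨b, -, hb⟩ := Finset.mem_image.1 hay
      obtain ⟨rfl, h2⟩ := hpt _ _ _ _ hb
      refine Finset.mem_biUnion.2 ⟨y, hy, ?_⟩
      rw [Multiset.mem_toFinset, Polynomial.mem_roots, Polynomial.IsRoot, Polynomial.eval_sub, h2,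
        sub_self]
      rw [sub_ne_zero]
      intro he
      exact hxY (hinj x y hx (Finset.mem_range.1 (hY hy)) he ▸ hy)
    have h1 := Finset.card_le_card hcover
    have h2 : (Y.biUnion fun y => (P x - P y).roots.toFinset).card ≤ Y.card * d :=
      Finset.card_biUnion_le_card_mul _ _ _ fun y _ =>
        (Multiset.toFinset_card_le _).trans ((Polynomial.card_roots' _).trans
          ((Polynomial.natDegree_sub_le _ _).trans (max_le (hdeg x) (hdeg y))))
    rw [Finset.card_univ, ZMod.card] at h1
    have h3 := Nat.mul_le_mul_right d hcY
    omega

/-- Bertrand's postulate supplies a prime in `(A * d, 2 * (A * d)]`. -/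
theorem exists_isCoverFree {A d m : ℕ} (hA : 0 < A) (hd : 0 < d) (hm : m ≤ (A * d + 1) ^ (d + 1)) :
    ∃ F, IsCoverFree A m ((2 * (A * d)) ^ 2) F := by
  obtain ⟨q, hq, h1, h2⟩ := Nat.exists_prime_lt_and_le_two_mul (A * d) (by positivity)
  obtain ⟨F, hF⟩ := exists_isCoverFree_of_prime hq h1
  exact ⟨F, (hF.mono (hm.trans (Nat.pow_le_pow_left h1 _))).mono_ground (Nat.pow_le_pow_left h2 _)⟩

/-! ### The number of steps of Linial's algorithm -/

theorem linialSize_succ_le {A N i d : ℕ} (hA : 0 < A) (hd : 0 < d)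
    (hm : linialSize A N i ≤ (A * d + 1) ^ (d + 1)) :
    linialSize A N (i + 1) ≤ (2 * (A * d)) ^ 2 :=
  Nat.sInf_le (s := {s | ∃ F, IsCoverFree A (linialSize A N i) s F}) (exists_isCoverFree hA hd hm)

/-- An upper bound for the number of colours after a step of Linial's algorithm, from `x` colours, as
long as this number is large. -/
def linialBound (x : ℕ) : ℕ := 4 * (Nat.log 2 x + 1) ^ 4

/-- Take degree `l`, about `log x`. If `A ≤ l`, the new size `4 * (A * l) ^ 2` is at most `4 * l ^
4`, independent of `A`. Otherwise it is at most `4 * A ^ 4`, and one extra step with polynomials of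
degree 4 reaches `64 * A ^ 2`; this accounts for the `i + 1`. -/
theorem linialSize_le_or {A N : ℕ} (hA : 0 < A) (i : ℕ) :
    (∃ j ≤ i + 1, linialSize A N j ≤ 64 * A ^ 2) ∨ linialSize A N i ≤ linialBound^[i] N := by
  induction i with
  | zero => exact Or.inr le_rfl
  | succ i ih =>
    rcases ih with ⟨j, hj, h⟩ | h
    · exact Or.inl ⟨j, by omega, h⟩
    rw [Function.iterate_succ_apply']
    set x := linialBound^[i] N
    set l := Nat.log 2 x + 1 with hl
    have hx : linialSize A N i ≤ (A * l + 1) ^ (l + 1) := by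
      calc linialSize A N i ≤ x := h
        _ ≤ 2 ^ l := (Nat.lt_pow_succ_log_self (by norm_num) x).le
        _ ≤ (A * l + 1) ^ l := Nat.pow_le_pow_left (by nlinarith) _
        _ ≤ (A * l + 1) ^ (l + 1) := Nat.pow_le_pow_right (by omega) (by omega)
    have h1 := linialSize_succ_le hA (Nat.succ_pos _) hx
    rcases le_total A l with hAl | hAl
    · right
      calc linialSize A N (i + 1) ≤ (2 * (A * l)) ^ 2 := h1
        _ ≤ (2 * (l * l)) ^ 2 := by gcongr
        _ = linialBound x := by rw [linialBound]; ring
    · left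
      refine ⟨i + 1 + 1, le_rfl, ?_⟩
      have h2 := linialSize_succ_le (A := A) (N := N) (i := i + 1) (d := 4) hA (by norm_num) <| by
        calc linialSize A N (i + 1) ≤ (2 * (A * l)) ^ 2 := h1
          _ ≤ (2 * (A * A)) ^ 2 := by gcongr
          _ = 4 * A ^ 4 := by ring
          _ ≤ (A * 4 + 1) * (A * 4 + 1) ^ 4 := by
            gcongr
            · omega
            · omega
          _ = _ := by ring
      calc linialSize A N (i + 1 + 1) ≤ (2 * (A * 4)) ^ 2 := h2
        _ = 64 * A ^ 2 := by ring

theorem linialSteps_le {c A N i : ℕ} (hc : 64 ≤ c) (hA : 0 < A) (hi : linialBound^[i] N ≤ c) :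
    (∃ j, linialSize A N j ≤ c * A ^ 2) ∧ linialSteps c A N ≤ i + 1 := by
  have : ∃ j ≤ i + 1, linialSize A N j ≤ c * A ^ 2 := by
    rcases linialSize_le_or hA i with ⟨j, hj, h⟩ | h
    · exact ⟨j, hj, h.trans (Nat.mul_le_mul_right _ hc)⟩
    · refine ⟨i, by omega, (h.trans hi).trans ?_⟩
      exact Nat.le_mul_of_pos_right _ (by positivity)
  obtain ⟨j, hj, h⟩ := this
  exact ⟨⟨j, h⟩, (Nat.sInf_le (s := {i | linialSize A N i ≤ c * A ^ 2}) h).trans hj⟩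

theorem four_mul_pow_lt_two_pow {n : ℕ} (hn : 24 ≤ n) : 4 * (n + 5) ^ 4 < 2 ^ n := by
  induction n, hn using Nat.le_induction with
  | base => norm_num
  | succ n hn ih =>
    have : (n + 1 + 5) ^ 4 ≤ 2 * (n + 5) ^ 4 := by
      obtain ⟨k, rfl⟩ := Nat.exists_eq_add_of_le hn
      ring_nf
      nlinarith [sq_nonneg k, Nat.zero_le (k ^ 3), Nat.zero_le (k ^ 4)]
    rw [pow_succ 2 n]
    omega

theorem linialBound_mono : Monotone linialBound := fun _ _ h =>
  Nat.mul_le_mul_left _ (Nat.pow_le_pow_left (Nat.succ_le_succ (Nat.log_mono_right h)) _)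

theorem linialBound_le (x : ℕ) : linialBound x ≤ max (2 ^ 24) (x - 1) := by
  rcases le_total x (2 ^ 24) with hx | hx
  · refine le_max_of_le_left ((linialBound_mono hx).trans ?_)
    rw [linialBound, Nat.log_pow (by norm_num)]
    norm_num
  · refine le_max_of_le_right (Nat.le_sub_one_of_lt ?_)
    have h1 : 24 ≤ Nat.log 2 x := by
      rw [← Nat.log_pow (b := 2) (by norm_num) 24]
      exact Nat.log_mono_right hx
    calc linialBound x ≤ 4 * (Nat.log 2 x + 5) ^ 4 := by
          unfold linialBound
          gcongr
          norm_num
      _ < 2 ^ Nat.log 2 x := four_mul_pow_lt_two_pow h1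
      _ ≤ x := Nat.pow_log_le_self 2 (by omega)

/-- A crude rate that is enough to bring a bound depending on `κ` down to an absolute constant in a
number of steps depending on `κ` only. -/
theorem linialBound_iterate_le (j x : ℕ) : linialBound^[j] x ≤ max (2 ^ 24) (x - j) := by
  induction j with
  | zero => exact le_max_right _ _
  | succ j ih =>
    rw [Function.iterate_succ_apply']
    refine (linialBound_le _).trans (max_le (le_max_left _ _) ?_)
    omega

/-! ### Iterated logarithms -/

theorem iterLog_zero (x : ℝ) : iterLog 0 x = x := rfl

theorem iterLog_succ (i : ℕ) (x : ℝ) : iterLog (i + 1) x = Real.logb 2 (iterLog i x) :=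
  Function.iterate_succ_apply' _ _ _

theorem add_one_le_two_rpow {y : ℝ} (hy : 1 ≤ y) : y + 1 ≤ (2 : ℝ) ^ y := by
  have := one_add_mul_self_le_rpow_one_add (s := 1) (by norm_num) hy
  norm_num at this
  linarith

theorem logb_two_le_sub_one {x : ℝ} (hx : 2 ≤ x) : Real.logb 2 x ≤ x - 1 := by
  rw [Real.logb_le_iff_le_rpow (by norm_num) (by linarith)]
  have := add_one_le_two_rpow (y := x - 1) (by linarith)
  linarith

theorem exists_iterLog_le_two (n : ℕ) : ∃ i, iterLog i n ≤ 2 := by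
  by_contra! h
  have key : ∀ i : ℕ, iterLog i n ≤ n - i := by
    intro i
    induction i with
    | zero => simp [iterLog_zero]
    | succ i ih =>
      rw [iterLog_succ]
      have := logb_two_le_sub_one (h i).le
      push_cast
      linarith
  have h1 := key n
  have h2 := h n
  linarith

theorem iterLog_logStar_le (n : ℕ) : iterLog (logStar n) n ≤ 2 :=
  Nat.sInf_mem (s := {i | iterLog i n ≤ 2}) (exists_iterLog_le_two n)

theorem two_lt_iterLog {n i : ℕ} (h : i < logStar n) : 2 < iterLog i n := by
  by_contra! h'
  exact absurd (Nat.sInf_le (s := {i | iterLog i n ≤ 2}) h') (not_le.2 h)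

theorem natLog_le_logb {x : ℕ} {y : ℝ} (hxy : (x : ℝ) ≤ y) (hy : 1 ≤ y) :
    (Nat.log 2 x : ℝ) ≤ Real.logb 2 y := by
  rcases Nat.eq_zero_or_pos x with rfl | hx
  · simpa using Real.logb_nonneg (by norm_num) hy
  · rw [Real.le_logb_iff_rpow_le (by norm_num) (by linarith), Real.rpow_natCast]
    refine le_trans ?_ hxy
    exact_mod_cast Nat.pow_log_le_self 2 hx.ne'

/-- The constant reproduces itself: the logarithm of `2 ^ (κ + 24) * z ^ 4`, plus 1, is at most `(κ
+ 29) * max (log z) 2`, and `4 * (κ + 29) ^ 4 ≤ 2 ^ (κ + 24)`. -/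
theorem linialBound_iterate_le_iterLog {κ n : ℕ} (hn : 3 ≤ n) (i : ℕ) (hi : i < logStar n) :
    ((linialBound^[i + 1] (n ^ κ + 1) : ℕ) : ℝ) ≤
      2 ^ (κ + 24) * (max (iterLog (i + 1) n) 2) ^ 4 := by
  have hn' : (3 : ℝ) ≤ n := by exact_mod_cast hn
  have hE : ∀ z : ℝ, 0 ≤ z → 4 * (((κ + 24 : ℕ) + 5) * z) ^ 4 ≤ 2 ^ (κ + 24) * z ^ 4 := by
    intro z hz
    have h1 : 4 * ((κ + 24) + 5) ^ 4 ≤ 2 ^ (κ + 24) :=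
      (four_mul_pow_lt_two_pow (by omega)).le
    have h2 : (4 * (((κ + 24 : ℕ) : ℝ) + 5) ^ 4) ≤ 2 ^ (κ + 24) := by exact_mod_cast h1
    calc _ = (4 * (((κ + 24 : ℕ) : ℝ) + 5) ^ 4) * z ^ 4 := by ring
      _ ≤ _ := by gcongr
  have step : ∀ (x : ℕ) (z : ℝ), 2 ≤ z → (Nat.log 2 x : ℝ) + 1 ≤ ((κ + 24 : ℕ) + 5) * z →
      ((linialBound x : ℕ) : ℝ) ≤ 2 ^ (κ + 24) * z ^ 4 := by
    intro x z hz h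
    refine le_trans ?_ (hE z (by linarith))
    unfold linialBound
    push_cast
    push_cast at h
    gcongr
  rw [Function.iterate_succ_apply']
  refine step _ _ (le_max_right _ _) ?_
  have hz := le_max_right (iterLog (i + 1) n) 2
  have hzl := le_max_left (iterLog (i + 1) n) 2
  set z := max (iterLog (i + 1) n) 2 with hzdef
  induction i with
  | zero =>
    have h1 : ((n ^ κ + 1 : ℕ) : ℝ) ≤ (n : ℝ) ^ (κ + 1) := by
      push_cast
      rw [pow_succ]
      have : (1 : ℝ) ≤ (n : ℝ) ^ κ := one_le_pow₀ (by linarith)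
      nlinarith
    have h2 := natLog_le_logb h1 (one_le_pow₀ (by linarith))
    rw [Real.logb_pow] at h2
    rw [iterLog_succ, iterLog_zero] at hzl
    have h3 : ((κ + 1 : ℕ) : ℝ) * Real.logb 2 n ≤ (κ + 1 : ℕ) * z := by gcongr
    simp only [Function.iterate_zero, id]
    push_cast at h2 h3 ⊢
    nlinarith
  | succ i ih =>
    have hprev := step _ _ (le_max_right (iterLog (i + 1) n) 2)
      (ih (by omega) (le_max_right _ _) (le_max_left _ _) rfl)
    have hgt := two_lt_iterLog hi
    rw [max_eq_left hgt.le] at hprev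
    rw [Function.iterate_succ_apply']
    have h2 := natLog_le_logb hprev (by
      have : (1 : ℝ) ≤ 2 ^ (κ + 24) := one_le_pow₀ (by norm_num)
      have : (1 : ℝ) ≤ iterLog (i + 1) n ^ 4 := one_le_pow₀ (by linarith)
      nlinarith)
    rw [Real.logb_mul (by positivity) (by positivity), Real.logb_pow, Real.logb_pow,
      Real.logb_self_eq_one (by norm_num), ← iterLog_succ] at h2
    push_cast at h2 ⊢
    nlinarith [(Nat.cast_nonneg κ : (0 : ℝ) ≤ κ)]

theorem one_le_logStar {n : ℕ} (hn : 3 ≤ n) : 1 ≤ logStar n := by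
  by_contra! h
  have h1 := iterLog_logStar_le n
  rw [Nat.lt_one_iff.1 h, iterLog_zero] at h1
  have : (3 : ℝ) ≤ n := by exact_mod_cast hn
  linarith

theorem exists_linialSteps_le : ∃ c : ℕ, 64 ≤ c ∧ ∀ κ : ℕ, ∃ B : ℕ, ∀ n : ℕ, 3 ≤ n →
    ∀ A : ℕ, 0 < A → (∃ i, linialSize A (n ^ κ + 1) i ≤ c * A ^ 2) ∧
      linialSteps c A (n ^ κ + 1) ≤ B * logStar n := by
  -- The constant `c` must not depend on `κ`: `log* n` steps lead to `E = 2 ^ (κ + 28)`, and `E`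
  -- further steps lead to `c`.
  obtain ⟨c, hc⟩ : ∃ c, c = 2 ^ 24 := ⟨_, rfl⟩
  refine ⟨c, by rw [hc]; norm_num, fun κ => ?_⟩
  obtain ⟨E, hE⟩ : ∃ E, E = 2 ^ (κ + 28) := ⟨_, rfl⟩
  refine ⟨E + 2, fun n hn A hA => ?_⟩
  have hpos := one_le_logStar hn
  obtain ⟨i, hi⟩ : ∃ i, logStar n = i + 1 := ⟨logStar n - 1, by omega⟩
  have h1 := linialBound_iterate_le_iterLog (κ := κ) hn i (by omega)
  have h2 := iterLog_logStar_le n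
  rw [hi] at h2
  rw [max_eq_right h2] at h1
  have h3 : linialBound^[i + 1] (n ^ κ + 1) ≤ E := by
    have : (2 : ℝ) ^ (κ + 24) * 2 ^ 4 = 2 ^ (κ + 28) := by ring
    rw [this] at h1
    rw [hE]
    exact_mod_cast h1
  have h4 : linialBound^[E + (i + 1)] (n ^ κ + 1) ≤ c := by
    rw [Function.iterate_add_apply, hc]
    refine (linialBound_iterate_le _ _).trans (max_le le_rfl ?_)
    rw [Nat.sub_eq_zero_of_le h3]
    exact Nat.zero_le _
  obtain ⟨h5, h6⟩ := linialSteps_le (by rw [hc]; norm_num) hA h4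
  refine ⟨h5, h6.trans ?_⟩
  have : (E + 2) * (i + 1) = E + (i + 1) + 1 + (E * i + i) := by ring
  rw [hi, this]
  exact Nat.le_add_right _ _

/-! ### The number of iterations of Procedure Defective-Color -/

/-- While the palette has at least `q` colors, an iteration multiplies it by at most `p ^ 2 / q`;
once it is below `q`, there is a single interval and one more iteration gives `p ^ 2` colors. -/
theorem dcNext_iterate_le {p q : ℕ} (hpq : p ^ 2 < q) (χ i : ℕ) :
    (dcNext p q)^[i] χ ≤ p ^ 2 ∨ (dcNext p q)^[i] χ * q ^ i ≤ χ * p ^ (2 * i) := by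
  have hq : 0 < q := by omega
  induction i with
  | zero => right; simp
  | succ i ih =>
    rw [Function.iterate_succ_apply']
    set x := (dcNext p q)^[i] χ
    rcases lt_or_ge x q with hx | hx
    · left
      simp [dcNext, Nat.div_eq_of_lt hx]
    · right
      have h1 : x * q ^ i ≤ χ * p ^ (2 * i) := ih.resolve_left (by omega)
      have h2 : dcNext p q x = x / q * p ^ 2 := by
        rw [dcNext, max_eq_left ((Nat.one_le_div_iff hq).2 hx)]
      calc dcNext p q x * q ^ (i + 1) = (x / q * q) * q ^ i * p ^ 2 := by rw [h2]; ring
        _ ≤ x * q ^ i * p ^ 2 := by gcongr; exact Nat.div_mul_le_self _ _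
        _ ≤ χ * p ^ (2 * i) * p ^ 2 := by gcongr
        _ = _ := by ring

/-- Over `3 * s` iterations the gain is `p ^ (6 * s) ≤ q ^ (2 * s)` against `q ^ (3 * s)`, which
outweighs the initial `q ^ s`. -/
theorem dcIters_spec {p q χ s : ℕ} (hp : 0 < p) (hpq : p ^ 2 < q) (hpq' : p ^ 3 ≤ q)
    (hχ : χ ≤ q ^ s) :
    dcIters p q χ ≤ 3 * s ∧ (dcNext p q)^[dcIters p q χ] χ ≤ p ^ 2 := by
  have hq : 0 < q := by omega
  have hmem : (dcNext p q)^[3 * s] χ ≤ p ^ 2 := by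
    rcases dcNext_iterate_le hpq χ (3 * s) with h | h
    · exact h
    · have h1 : (dcNext p q)^[3 * s] χ * q ^ (3 * s) ≤ 1 * q ^ (3 * s) := by
        calc (dcNext p q)^[3 * s] χ * q ^ (3 * s) ≤ χ * p ^ (2 * (3 * s)) := h
          _ ≤ q ^ s * p ^ (2 * (3 * s)) := by gcongr
          _ = q ^ s * (p ^ 3) ^ (2 * s) := by rw [← pow_mul]; congr 2; ring
          _ ≤ q ^ s * q ^ (2 * s) := by gcongr
          _ = 1 * q ^ (3 * s) := by rw [one_mul, ← pow_add]; congr 1; ring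
      exact (Nat.le_of_mul_le_mul_right h1 (by positivity)).trans (Nat.one_le_pow _ _ hp)
  exact ⟨Nat.sInf_le (s := {i | (dcNext p q)^[i] χ ≤ p ^ 2}) hmem,
    Nat.sInf_mem (s := {i | (dcNext p q)^[i] χ ≤ p ^ 2}) ⟨_, hmem⟩⟩

theorem one_le_dcIters {p q χ : ℕ} (hχ : p ^ 2 < χ)
    (hit : (dcNext p q)^[dcIters p q χ] χ ≤ p ^ 2) : 1 ≤ dcIters p q χ := by
  by_contra! h
  rw [Nat.lt_one_iff.1 h] at hit
  exact absurd hit (not_le.2 hχ)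

/-! ### Parameters of Procedure Defective-Color -/

theorem le_mul_two_mul_div {p Λ : ℕ} (hp : 0 < p) (h : p ≤ Λ) : Λ ≤ Λ / p * (2 * p) := by
  have h1 := Nat.div_add_mod Λ p
  have h2 := Nat.mod_lt Λ hp
  have h3 : 1 * p ≤ Λ / p * p := Nat.mul_le_mul_right _ ((Nat.one_le_div_iff hp).2 h)
  nlinarith

theorem dcDefect_mul_le {p q χ Λ R : ℕ} (h : dcIters p q χ ≤ R) :
    dcDefect p q χ Λ * p ≤ R * Λ := by
  rw [dcDefect, Nat.mul_assoc]
  exact Nat.mul_le_mul h (Nat.div_mul_le_self _ _)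

/-- At least one iteration takes place, so `d ≥ ⌊Λ / p⌋ ≥ Λ / (2 * p) ≥ √Λ`. The defect bound is
thus large enough for a single cover-free step from `c * Λ ^ 2` to `c * d ^ 2` colors. -/
theorem dcDefect_spec {c p q s Λ : ℕ} (hc : 64 ≤ c) (hp : 0 < p) (hpq : p ^ 2 < q)
    (hpq' : p ^ 3 ≤ q) (hχ : c * Λ ^ 2 ≤ q ^ s) (hpΛ : (2 * p) ^ 2 ≤ Λ) (hcΛ : c ^ 2 ≤ Λ) :
    Λ ≤ dcDefect p q (c * Λ ^ 2) Λ ^ 2 ∧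
      ∃ F, IsCoverFree (dcDefect p q (c * Λ ^ 2) Λ) (c * Λ ^ 2)
        (c * dcDefect p q (c * Λ ^ 2) Λ ^ 2) F := by
  obtain ⟨-, hit⟩ := dcIters_spec hp hpq hpq' hχ
  have hΛ : 0 < Λ := by nlinarith
  have hiters : 1 ≤ dcIters p q (c * Λ ^ 2) := by
    refine one_le_dcIters ?_ hit
    nlinarith
  have hd1 : Λ ≤ dcDefect p q (c * Λ ^ 2) Λ * (2 * p) :=
    (le_mul_two_mul_div hp (by nlinarith)).trans
      (Nat.mul_le_mul_right _ (Nat.le_mul_of_pos_left _ hiters))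
  set d := dcDefect p q (c * Λ ^ 2) Λ
  have hd : Λ ≤ d ^ 2 := by
    refine Nat.le_of_mul_le_mul_right (c := Λ) ?_ hΛ
    calc Λ * Λ ≤ (d * (2 * p)) * (d * (2 * p)) := Nat.mul_le_mul hd1 hd1
      _ = d ^ 2 * (2 * p) ^ 2 := by ring
      _ ≤ d ^ 2 * Λ := Nat.mul_le_mul_left _ hpΛ
  have hcd : c ≤ d := (Nat.pow_le_pow_iff_left (n := 2) (by norm_num)).1 (hcΛ.trans hd)
  have hd0 : 0 < d := by omega
  refine ⟨hd, ?_⟩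
  -- Degree 4 suffices because `c * Λ ^ 2 ≤ d ^ 5`.
  obtain ⟨F, hF⟩ := exists_isCoverFree (A := d) (d := 4) (m := c * Λ ^ 2) hd0 (by norm_num) <| by
    calc c * Λ ^ 2 ≤ d * (d ^ 2) ^ 2 := by gcongr
      _ = d ^ (4 + 1) := by ring
      _ ≤ (d * 4 + 1) ^ (4 + 1) := Nat.pow_le_pow_left (by omega) _
  refine ⟨F, hF.mono_ground ?_⟩
  calc (2 * (d * 4)) ^ 2 = 64 * d ^ 2 := by ring
    _ ≤ c * d ^ 2 := Nat.mul_le_mul_right _ hc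

/-- Halving the exponent is a convenient way to absorb the loss from rounding down. -/
theorem rpow_half_le_floor {x α : ℝ} (hx : 0 < x) (h : 2 ≤ x ^ (α / 2)) :
    x ^ (α / 2) ≤ (⌊x ^ α⌋₊ : ℝ) := by
  have h1 : x ^ α = x ^ (α / 2) * x ^ (α / 2) := by
    rw [← Real.rpow_add hx]
    ring_nf
  have h2 := Nat.lt_floor_add_one (x ^ α)
  nlinarith

theorem pow_le_pow_of_rpow_le {Λ q s : ℕ} {β : ℝ} (n : ℕ) (hΛ : 1 ≤ Λ) (hq : (Λ : ℝ) ^ β ≤ q)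
    (hs : n ≤ β * s) : Λ ^ n ≤ q ^ s := by
  have hΛ' : (1 : ℝ) ≤ Λ := by exact_mod_cast hΛ
  have h : ((Λ : ℝ)) ^ n ≤ (q : ℝ) ^ s := by
    calc (Λ : ℝ) ^ n = (Λ : ℝ) ^ (n : ℝ) := (Real.rpow_natCast _ _).symm
      _ ≤ (Λ : ℝ) ^ (β * s) := Real.rpow_le_rpow_of_exponent_le hΛ' hs
      _ = ((Λ : ℝ) ^ β) ^ s := by rw [Real.rpow_mul (by linarith), Real.rpow_natCast]
      _ ≤ _ := by gcongr
  exact_mod_cast h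

/-! ### Bounds for the Kuhn-Wattenhofer procedure -/

theorem natClog_le_logb {a : ℕ} (ha : 1 ≤ a) : (Nat.clog 2 a : ℝ) ≤ Real.logb 2 a + 1 := by
  have ha' : (1 : ℝ) ≤ a := by exact_mod_cast ha
  rcases Nat.lt_or_ge 1 a with h | h
  · have h1 := Nat.pow_pred_clog_lt_self (b := 2) (by norm_num) h
    have h2 : ((Nat.clog 2 a).pred : ℝ) ≤ Real.logb 2 a := by
      rw [Real.le_logb_iff_rpow_le (by norm_num) (by linarith), Real.rpow_natCast]
      exact_mod_cast h1.le
    have h3 : Nat.clog 2 a = (Nat.clog 2 a).pred + 1 :=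
      (Nat.succ_pred_eq_of_pos (Nat.clog_pos (by norm_num) h)).symm
    rw [h3]
    push_cast
    linarith
  · rw [Nat.clog_of_right_le_one h]
    have := Real.logb_nonneg (b := 2) (by norm_num) ha'
    push_cast
    linarith

theorem kwTime_le {Λ m a : ℕ} {l : ℝ} (hΛ : 1 ≤ Λ) (ha : 1 ≤ a) (hm : m ≤ a * (Λ + 1))
    (hl : Real.logb 2 a + 1 ≤ l) : (kwTime Λ m : ℝ) ≤ 2 * Λ * l := by
  have h1 : m ⌈/⌉ (Λ + 1) ≤ a := by
    rw [ceilDiv_le_iff_le_smul (Nat.succ_pos _), smul_eq_mul, Nat.mul_comm]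
    exact hm
  have h2 : (Nat.clog 2 (m ⌈/⌉ (Λ + 1)) : ℝ) ≤ l := by
    refine le_trans ?_ ((natClog_le_logb ha).trans hl)
    exact_mod_cast Nat.clog_mono_right 2 h1
  have hΛ' : (1 : ℝ) ≤ Λ := by exact_mod_cast hΛ
  have h0 : (0 : ℝ) ≤ (Nat.clog 2 (m ⌈/⌉ (Λ + 1)) : ℝ) := Nat.cast_nonneg _
  rw [kwTime]
  push_cast
  nlinarith

theorem logb_two_natCast_le (n : ℕ) : Real.logb 2 (n + 1) ≤ n := by
  rw [Real.logb_le_iff_le_rpow (by norm_num) (by positivity), Real.rpow_natCast]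
  exact_mod_cast Nat.lt_two_pow_self

theorem kwTime_base_le {c Λ : ℕ} (hc : 1 ≤ c) (hΛ : 1 ≤ Λ) :
    (kwTime Λ (c * Λ ^ 2) : ℝ) ≤ 2 * Λ * (Real.logb 2 Λ + c) := by
  refine kwTime_le (a := c * Λ) hΛ (Nat.mul_pos hc hΛ) (by nlinarith [Nat.mul_pos hc hΛ]) ?_
  obtain ⟨c, rfl⟩ := Nat.exists_eq_add_of_le' hc
  have := logb_two_natCast_le c
  push_cast
  rw [Real.logb_mul (by positivity) (by positivity)]
  linarith

/-! ### Iterated logarithms of polynomially related numbers -/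

theorem logb_two_add_le {x a : ℝ} (hx : 1 ≤ x) (ha : 1 ≤ a) :
    Real.logb 2 (x + a) ≤ Real.logb 2 x + a := by
  rw [Real.logb_le_iff_le_rpow (by norm_num) (by linarith), Real.rpow_add (by norm_num),
    Real.rpow_logb (by norm_num) (by norm_num) (by linarith)]
  have := add_one_le_two_rpow ha
  nlinarith

theorem logb_two_sub_one_le {x y : ℝ} (hx : 2 ≤ x) (h : x - 1 ≤ y) :
    Real.logb 2 x - 1 ≤ Real.logb 2 y := by
  have h1 : Real.logb 2 x - 1 = Real.logb 2 (x / 2) := by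
    rw [Real.logb_div (by linarith) (by norm_num), Real.logb_self_eq_one (by norm_num)]
  rw [h1]
  exact Real.logb_le_logb_of_le (by norm_num) (by linarith) (by linarith)

theorem logb_two_le_sub_two {x : ℝ} (hx : 4 ≤ x) : Real.logb 2 x ≤ x - 2 := by
  rw [Real.logb_le_iff_le_rpow (by norm_num) (by linarith)]
  have := add_one_le_two_rpow (y := x - 3) (by linarith)
  have h2 : (2 : ℝ) ^ (x - 2) = 2 ^ (x - 3) * 2 := by
    rw [← Real.rpow_add_one (by norm_num)]
    ring_nf
  linarith

theorem four_le_of_two_le_logb {x : ℝ} (hx : 0 < x) (h : 2 ≤ Real.logb 2 x) : 4 ≤ x := by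
  rw [Real.le_logb_iff_rpow_le (by norm_num) hx] at h
  norm_num at h
  linarith

/-- The logarithm of `Λ` is not too small, and small in comparison with `Λ`. -/
structure IsLarge (Λ : ℝ) : Prop where
  four_le_logb : 4 ≤ Real.logb 2 Λ
  logb_le : 2 * Real.logb 2 Λ ≤ Real.sqrt Λ
  logb_logb_le : Real.logb 2 (Real.logb 2 Λ) + 1 ≤ Real.logb 2 Λ / 2

/-- `d` lies between the square root and a constant multiple of a large number `Λ`. -/
structure IsNear (R Λ d : ℝ) : Prop where
  one_le : 1 ≤ Λ
  isLarge : IsLarge Λ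
  one_le_const : 1 ≤ R
  sqrt_le : Real.sqrt Λ ≤ d
  le_mul : d ≤ 2 ^ R * Λ

section IterLog

variable {R Λ d : ℝ}

theorem IsNear.logb_near (hn : IsNear R Λ d) :
    Real.logb 2 Λ / 2 ≤ Real.logb 2 d ∧ Real.logb 2 d ≤ Real.logb 2 Λ + R := by
  obtain ⟨hΛ0, -, -, hd, hdR⟩ := hn
  have hs : 0 < Real.sqrt Λ := Real.sqrt_pos.2 (by linarith)
  constructor
  · have h1 : Real.logb 2 (Real.sqrt Λ) = Real.logb 2 Λ / 2 := by
      rw [Real.sqrt_eq_rpow, Real.logb_rpow_eq_mul_logb_of_pos (by linarith)]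
      ring
    rw [← h1]
    exact Real.logb_le_logb_of_le (by norm_num) hs hd
  · refine (Real.logb_le_logb_of_le (by norm_num) (by linarith) hdR).trans ?_
    rw [Real.logb_mul (by positivity) (by linarith), Real.logb_rpow (by norm_num) (by norm_num)]
    linarith

/-- Two logarithms turn the square root into an additive error of 1. Further logarithms do not
enlarge the errors `-1` and `+R`. -/
theorem IsNear.iterLog_near (hn : IsNear R Λ d) (i : ℕ) (hi : 2 ≤ i)
    (h : ∀ j < i, 2 ≤ iterLog j Λ) :
    iterLog i Λ - 1 ≤ iterLog i d ∧ iterLog i d ≤ iterLog i Λ + R := by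
  induction i, hi using Nat.le_induction with
  | base =>
    obtain ⟨h1, h2⟩ := hn.logb_near
    have h3 := hn.isLarge.four_le_logb
    simp only [iterLog_succ, iterLog_zero]
    constructor
    · refine le_trans (le_of_eq ?_) (Real.logb_le_logb_of_le (by norm_num) (by linarith) h1)
      rw [Real.logb_div (by linarith) (by norm_num), Real.logb_self_eq_one (by norm_num)]
    · exact (Real.logb_le_logb_of_le (by norm_num) (by linarith) h2).trans
        (logb_two_add_le (by linarith) hn.one_le_const)
  | succ i hi ih =>
    obtain ⟨h1, h2⟩ := ih fun j hj => h j (by omega)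
    have h3 := h i (by omega)
    rw [iterLog_succ, iterLog_succ]
    exact ⟨logb_two_sub_one_le h3 h1,
      (Real.logb_le_logb_of_le (by norm_num) (by linarith) h2).trans
        (logb_two_add_le (by linarith) hn.one_le_const)⟩

theorem IsNear.iterLog_le_add (hn : IsNear R Λ d) {i : ℕ} (hi : 1 ≤ i)
    (h : ∀ j < i, 2 ≤ iterLog j Λ) :
    iterLog i d ≤ iterLog i Λ + R := by
  rcases Nat.lt_or_ge 1 i with h1 | h1
  · exact (hn.iterLog_near i h1 h).2
  · obtain rfl : i = 1 := by omega
    exact (hn.logb_near).2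

/-- Dropping one logarithm gains more than passing from `Λ` to `d` loses. So the iterated logarithm
relevant to the next recursion level has grown by at least 1. -/
theorem IsNear.iterLog_add_one_le (hn : IsNear R Λ d) {i : ℕ} (h : ∀ j ≤ i + 1, 2 ≤ iterLog j Λ) :
    iterLog (i + 1) Λ + 1 ≤ iterLog i d := by
  have h4 := hn.isLarge.four_le_logb
  match i with
  | 0 =>
    have := hn.isLarge.logb_le
    have := hn.sqrt_le
    rw [iterLog_succ, iterLog_zero, iterLog_zero]
    linarith
  | 1 =>
    have h1 := (hn.logb_near).1
    have := hn.isLarge.logb_logb_le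
    simp only [iterLog_succ, iterLog_zero]
    linarith
  | i + 2 =>
    have h1 := (hn.iterLog_near (i + 2) (by omega) fun j hj => h j (by omega)).1
    have h2 := h (i + 2 + 1) le_rfl
    have h3 := h (i + 2) (by omega)
    rw [iterLog_succ] at h2 ⊢
    have := logb_two_le_sub_two (four_le_of_two_le_logb (by linarith) h2)
    linarith

theorem IsNear.two_le_iterLog (hn : IsNear R Λ d) {i : ℕ}
    (h : ∀ j ≤ i + 1, 2 ≤ iterLog j Λ) (j : ℕ) (hj : j ≤ i) :
    2 ≤ iterLog j d := by
  have h1 := hn.iterLog_add_one_le (i := j) fun l hl => h l (by omega)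
  have h2 := h (j + 1) (by omega)
  linarith

end IterLog

/-! ### Bounds that hold for large parameters -/

theorem eventually_logb_le_rpow {α : ℝ} (hα : 0 < α) :
    ∀ᶠ x : ℝ in atTop, Real.logb 2 x ≤ x ^ α := by
  have h2 : 0 < Real.log 2 := Real.log_pos (by norm_num)
  filter_upwards [(isLittleO_log_rpow_atTop hα).bound h2, eventually_ge_atTop 1] with x h hx
  rw [Real.norm_of_nonneg (Real.log_nonneg hx), Real.norm_of_nonneg (by positivity)] at h
  rw [Real.logb, div_le_iff₀ h2]
  linarith

theorem eventually_le_rpow {α : ℝ} (hα : 0 < α) (b : ℝ) : ∀ᶠ x : ℝ in atTop, b ≤ x ^ α :=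
  (tendsto_rpow_atTop hα).eventually_ge_atTop b

theorem tendsto_logb_two : Tendsto (Real.logb 2) atTop atTop :=
  Real.tendsto_logb_atTop (by norm_num)

theorem eventually_two_mul_logb_le_sqrt : ∀ᶠ x : ℝ in atTop, 2 * Real.logb 2 x ≤ Real.sqrt x := by
  filter_upwards [eventually_logb_le_rpow (α := 1 / 4) (by norm_num),
    eventually_le_rpow (α := 1 / 4) (by norm_num) 2, eventually_gt_atTop 0] with x h1 h2 hx
  have : Real.sqrt x = x ^ (1 / 4 : ℝ) * x ^ (1 / 4 : ℝ) := by
    rw [Real.sqrt_eq_rpow, ← Real.rpow_add hx]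
    norm_num
  nlinarith

theorem eventually_isLarge : ∀ᶠ x : ℝ in atTop, IsLarge x := by
  have h : ∀ᶠ y : ℝ in atTop, Real.logb 2 y + 1 ≤ y / 2 := by
    filter_upwards [eventually_two_mul_logb_le_sqrt, eventually_ge_atTop 4] with y h1 h2
    have h3 := Real.sq_sqrt (show 0 ≤ y by linarith)
    have h4 := Real.sqrt_nonneg y
    nlinarith [sq_nonneg (Real.sqrt y - 2)]
  filter_upwards [tendsto_logb_two.eventually_ge_atTop 4, eventually_two_mul_logb_le_sqrt,
    tendsto_logb_two.eventually h] with x h1 h2 h3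
  exact ⟨h1, h2, h3⟩

theorem eventually_logb_pow_three_add_one_le {δ : ℝ} (hδ : 0 < δ) :
    ∀ᶠ x : ℝ in atTop, Real.logb 2 x ^ 3 + 1 ≤ x ^ δ := by
  filter_upwards [eventually_logb_le_rpow (α := δ / 4) (by positivity),
    eventually_le_rpow (α := δ / 4) (by positivity) 2, eventually_ge_atTop 1] with x h1 h2 hx
  have h3 : x ^ δ = (x ^ (δ / 4)) ^ 4 := by
    rw [← Real.rpow_mul_natCast (by linarith)]
    congr 1
    push_cast
    ring
  have h4 := Real.logb_nonneg (b := 2) (by norm_num) hx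
  rw [h3]
  set y := x ^ (δ / 4)
  have h5 : Real.logb 2 x ^ 3 ≤ y ^ 3 := by gcongr
  have h6 : (1 : ℝ) ≤ y ^ 3 := one_le_pow₀ (by linarith)
  calc Real.logb 2 x ^ 3 + 1 ≤ y ^ 3 * 2 := by linarith
    _ ≤ y ^ 3 * y := by gcongr
    _ = y ^ 4 := by ring

/-- What an iteration of Procedure Delta-Color needs to know about `Λ`. -/
theorem exists_deltaColor_step {c : ℕ} (hc : 64 ≤ c) {δ : ℝ} (hδ : 0 < δ) (hδ1 : δ < 1) :
    ∃ R Λ₀ : ℕ, 1 ≤ R ∧ 1 ≤ Λ₀ ∧ ∀ Λ k q d : ℕ, Λ₀ ≤ Λ → IsLarge Λ ∧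
      (2 ≤ k → (k : ℝ) ≤ Real.logb 2 Λ → q = ⌊(Λ : ℝ) ^ δ⌋₊ → d = dcDefect k q (c * Λ ^ 2) Λ →
        0 < q ∧ q ≤ Λ ∧ dcIters k q (c * Λ ^ 2) ≤ R ∧
        (dcNext k q)^[dcIters k q (c * Λ ^ 2)] (c * Λ ^ 2) ≤ k ^ 2 ∧
        (∃ F, IsCoverFree d (c * Λ ^ 2) (c * d ^ 2) F) ∧ Real.sqrt Λ ≤ d ∧ d * k ≤ R * Λ) := by
  -- With `q ≥ Λ ^ (δ / 2)` and `δ / 2 * s ≥ 3`, the palette `c * Λ ^ 2 ≤ Λ ^ 3` is at most `q ^ s`.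
  obtain ⟨s, hs⟩ := exists_nat_ge (6 / δ)
  have hs6 : (6 : ℝ) ≤ δ * s := by
    rw [div_le_iff₀ hδ] at hs
    linarith
  have hs0 : 1 ≤ s := by
    rcases Nat.eq_zero_or_pos s with rfl | h
    · norm_num at hs6
    · exact h
  have hev : ∀ᶠ x : ℝ in atTop, IsLarge x ∧ Real.logb 2 x ^ 3 + 1 ≤ x ^ δ ∧ 2 ≤ x ^ (δ / 2) ∧
      (c : ℝ) ^ 2 ≤ x ∧ 1 ≤ x :=
    eventually_isLarge.and ((eventually_logb_pow_three_add_one_le hδ).and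
      ((eventually_le_rpow (by positivity) 2).and
        ((eventually_ge_atTop _).and (eventually_ge_atTop 1))))
  obtain ⟨Λ₀, hΛ₀⟩ := eventually_atTop.1 (tendsto_natCast_atTop_atTop.eventually hev)
  refine ⟨3 * s, Λ₀ + 1, by omega, by omega, fun Λ k q d hΛ => ?_⟩
  obtain ⟨h1, h2, h3, h4, h5⟩ := hΛ₀ Λ (by omega)
  refine ⟨h1, fun hk hkl hq hd => ?_⟩
  have hΛ1 : 1 ≤ Λ := by omega
  have hkpos : (2 : ℝ) ≤ k := by exact_mod_cast hk
  have hk3 : k ^ 3 ≤ q := by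
    rw [hq]
    apply Nat.le_floor
    push_cast
    calc (k : ℝ) ^ 3 ≤ Real.logb 2 Λ ^ 3 := by gcongr
      _ ≤ _ := by linarith
  have hk2 : k ^ 2 < q := by
    refine lt_of_lt_of_le ?_ hk3
    exact Nat.pow_lt_pow_right (by omega) (by norm_num)
  have hqΛ : q ≤ Λ := by
    rw [hq]
    refine Nat.floor_le_of_le ?_
    calc (Λ : ℝ) ^ δ ≤ (Λ : ℝ) ^ (1 : ℝ) := Real.rpow_le_rpow_of_exponent_le h5 hδ1.le
      _ = Λ := Real.rpow_one _
  have hcΛ : c ^ 2 ≤ Λ := by exact_mod_cast h4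
  have hχ : c * Λ ^ 2 ≤ q ^ s := by
    calc c * Λ ^ 2 ≤ Λ * Λ ^ 2 := Nat.mul_le_mul_right _ (by nlinarith)
      _ = Λ ^ 3 := by ring
      _ ≤ q ^ s := pow_le_pow_of_rpow_le (β := δ / 2) 3 hΛ1
        (hq ▸ rpow_half_le_floor (by linarith) h3) (by push_cast; linarith)
  have hkΛ : (2 * k) ^ 2 ≤ Λ := by
    have h6 : (2 * (k : ℝ)) ^ 2 ≤ Real.sqrt Λ ^ 2 := by
      have := h1.logb_le
      gcongr
      linarith
    rw [Real.sq_sqrt (by linarith)] at h6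
    exact_mod_cast h6
  obtain ⟨a1, a2⟩ := dcIters_spec (by omega) hk2 hk3 hχ
  obtain ⟨a3, a4⟩ := dcDefect_spec hc (by omega) hk2 hk3 hχ hkΛ hcΛ
  have a5 := dcDefect_mul_le (Λ := Λ) a1
  rw [← hd] at a3 a4 a5
  refine ⟨by omega, hqΛ, a1, a2, a4, ?_, a5⟩
  rw [Real.sqrt_le_left (Nat.cast_nonneg d)]
  exact_mod_cast a3

/-- The recurrence for the running time. If `m > 0`, the degree may grow by a factor `R`, and one
factor `R + 1` of the potential pays for it. If `m = 0`, then `x ≥ 8 * R` forces `d ≤ Λ / 4`. Either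
way a surplus `Λ * S` remains, which covers the lower-order terms. -/
theorem deltaColor_time_le {R Λ S x y l d K I T : ℝ} {m : ℕ} (hR : 1 ≤ R) (hΛ : 1 ≤ Λ)
    (hS : 10 * (R + 1) ^ 2 ≤ S) (hd : 0 ≤ d) (hdR : d ≤ R * Λ) (hdx : d * x ≤ 2 * R * Λ)
    (hK : K ≤ 2 * Λ * (l + R + 1)) (hI : I ≤ 2 * R * Λ)
    (hT : T ≤ 2 * d * (y + S * (R + 1) ^ (m - 1))) (hy : y ≤ x + R) (hm : 8 * R ≤ x + m) :
    I + (1 + (T + K)) ≤ 2 * Λ * (l + S * (R + 1) ^ m) := by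
  have hS0 : 0 ≤ S := le_trans (by positivity) hS
  have hdS : 2 * d * (S * (R + 1) ^ (m - 1)) ≤ 2 * Λ * (S * (R + 1) ^ m) - Λ * S := by
    rcases m with _ | m
    · have hx : 8 * R ≤ x := by simpa using hm
      have h1 : d * (8 * R) ≤ d * x := mul_le_mul_of_nonneg_left hx hd
      have h2 : (2 * R) * (4 * d) ≤ (2 * R) * Λ := by linarith
      have h3 : 4 * d ≤ Λ := le_of_mul_le_mul_left h2 (by linarith)
      have h4 : 4 * d * S ≤ Λ * S := mul_le_mul_of_nonneg_right h3 hS0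
      have h5 : 0 ≤ Λ * S := mul_nonneg (by linarith) hS0
      simp only [Nat.zero_sub, pow_zero, mul_one]
      linarith
    · simp only [Nat.add_sub_cancel]
      have h1 : (1 : ℝ) ≤ (R + 1) ^ m := one_le_pow₀ (by linarith)
      have h2 : d * (S * (R + 1) ^ m) ≤ R * Λ * (S * (R + 1) ^ m) := by gcongr
      have h3 : 2 * Λ * (S * (R + 1) ^ (m + 1)) =
        2 * (R * Λ * (S * (R + 1) ^ m)) + 2 * ((Λ * S) * (R + 1) ^ m) := by ring
      have h4 : (Λ * S) * 1 ≤ (Λ * S) * (R + 1) ^ m := by gcongr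
      have h5 : 0 ≤ Λ * S := by positivity
      linarith
  have h1 : d * y ≤ d * (x + R) := mul_le_mul_of_nonneg_left hy hd
  have h2 : d * R ≤ R * Λ * R := mul_le_mul_of_nonneg_right hdR (by linarith)
  have h3 : Λ * (10 * (R + 1) ^ 2) ≤ Λ * S := mul_le_mul_of_nonneg_left hS (by linarith)
  have h4 : 0 ≤ Λ * R := by positivity
  have h5 : 0 ≤ Λ * R ^ 2 := by positivity
  linarith

theorem exists_deltaBound {c : ℕ} (hc : 64 ≤ c) {δ : ℝ} (hδ : 0 < δ) (hδ1 : δ < 1) :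
    ∃ Λ₀ B : ℕ, ∀ Λ : ℕ, 1 ≤ Λ → ∃ T, DeltaBound c Λ₀ δ (logStar Λ) Λ T ∧ T ≤ B * Λ := by
  obtain ⟨R, Λ₀, hR, hΛ₀, hstep⟩ := exists_deltaColor_step hc hδ hδ1
  have hR' : (1 : ℝ) ≤ R := by exact_mod_cast hR
  set S : ℝ := 10 * (R + 1) ^ 2 + c + Λ₀ with hS
  have hc0 : (0 : ℝ) ≤ c := Nat.cast_nonneg c
  have hΛ₀0 : (0 : ℝ) ≤ Λ₀ := Nat.cast_nonneg Λ₀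
  have hpow : ∀ m : ℕ, (1 : ℝ) ≤ ((R : ℝ) + 1) ^ m := fun m => one_le_pow₀ (by linarith)
  have hS0 : 0 ≤ S := by positivity
  -- Here `m` bounds the number of recursive calls still to come before the degree is sure to
  -- contract.
  have main : ∀ (i m Λ : ℕ), 1 ≤ Λ → (∀ j ≤ i, 2 ≤ iterLog j Λ) → 8 * (R : ℝ) ≤ iterLog i Λ + m →
      ∃ T, DeltaBound c Λ₀ δ (i + 1) Λ T ∧
        (T : ℝ) ≤ 2 * Λ * (iterLog (i + 1) Λ + S * (R + 1) ^ m) := by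
    intro i
    induction i with
    | zero =>
      intro m Λ hΛ h _
      refine ⟨_, .base (Or.inl le_rfl), (kwTime_base_le (by omega) hΛ).trans ?_⟩
      rw [iterLog_succ, iterLog_zero]
      have : (c : ℝ) ≤ S * (R + 1) ^ m := by nlinarith [hpow m, sq_nonneg ((R : ℝ) + 1)]
      gcongr
    | succ i ih =>
      intro m Λ hΛ h hm
      have hx2 := h (i + 1) le_rfl
      have hΛ' : (1 : ℝ) ≤ Λ := by exact_mod_cast hΛ
      rcases Nat.lt_or_ge Λ Λ₀ with hlt | hge
      · refine ⟨_, .base (Or.inr hlt), (kwTime_base_le (by omega) hΛ).trans ?_⟩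
        have h1 : Real.logb 2 Λ ≤ Λ₀ := by
          rcases le_or_gt 2 (Λ : ℝ) with h2 | h2
          · have := logb_two_le_sub_one h2
            have : (Λ : ℝ) ≤ Λ₀ := by exact_mod_cast hlt.le
            linarith
          · have h3 := Real.logb_le_logb_of_le (b := 2) (by norm_num) (by linarith) h2.le
            rw [Real.logb_self_eq_one (by norm_num)] at h3
            have : (1 : ℝ) ≤ Λ₀ := by exact_mod_cast hΛ₀
            linarith
        have h2 : 0 ≤ iterLog (i + 1 + 1) Λ := by
          rw [iterLog_succ]
          exact Real.logb_nonneg (by norm_num) (by linarith)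
        have : (Λ₀ : ℝ) + c ≤ S * (R + 1) ^ m := by nlinarith [hpow m, sq_nonneg ((R : ℝ) + 1)]
        have h3 : Real.logb 2 Λ + c ≤ iterLog (i + 1 + 1) Λ + S * (R + 1) ^ m := by linarith
        gcongr
      · obtain ⟨k, hk⟩ : ∃ k, k = ⌊iterLog (i + 1) Λ⌋₊ := ⟨_, rfl⟩
        obtain ⟨q, hq⟩ : ∃ q, q = ⌊(Λ : ℝ) ^ δ⌋₊ := ⟨_, rfl⟩
        obtain ⟨d, hd⟩ : ∃ d, d = dcDefect k q (c * Λ ^ 2) Λ := ⟨_, rfl⟩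
        obtain ⟨hlarge, hpar⟩ := hstep Λ k q d hge
        set x := iterLog (i + 1) Λ with hx
        have hk2 : 2 ≤ k := by
          rw [hk]
          exact Nat.le_floor (by exact_mod_cast hx2)
        have hkx : (k : ℝ) ≤ x := by
          rw [hk]
          exact Nat.floor_le (by linarith)
        have hxk : x ≤ 2 * k := by
          have h1 := Nat.lt_floor_add_one x
          rw [← hk] at h1
          have : (2 : ℝ) ≤ k := by exact_mod_cast hk2
          linarith
        have hxlog : ∀ j, j ≤ i → iterLog (j + 1) Λ ≤ Real.logb 2 Λ := by
          intro j hj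
          induction j with
          | zero => exact le_of_eq (iterLog_succ 0 _)
          | succ j ihj =>
            have h1 := h (j + 1) (by omega)
            rw [iterLog_succ]
            have := logb_two_le_sub_one h1
            linarith [ihj (by omega)]
        obtain ⟨hq0, hqΛ, hit, hit', hF, hdlow, hdk⟩ :=
          hpar hk2 (hkx.trans (hxlog i le_rfl)) hq hd
        have hd1 : 1 ≤ d := by
          have : (1 : ℝ) ≤ d := (Real.one_le_sqrt.2 hΛ').trans hdlow
          exact_mod_cast this
        have hdk' : (d : ℝ) * k ≤ R * Λ := by exact_mod_cast hdk
        have hk2' : (2 : ℝ) ≤ k := by exact_mod_cast hk2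
        have hd0 : (0 : ℝ) ≤ d := Nat.cast_nonneg d
        have hdR : (d : ℝ) ≤ R * Λ := by nlinarith
        have hdx : d * x ≤ 2 * R * Λ := by nlinarith
        have hdR2 : (d : ℝ) ≤ 2 ^ (R : ℝ) * Λ := by
          have := add_one_le_two_rpow hR'
          nlinarith
        have hnear : IsNear R Λ d := ⟨hΛ', hlarge, hR', hdlow, hdR2⟩
        have hup := hnear.iterLog_le_add (i := i + 1) (by omega) fun j hj => h j (by omega)
        have hlow := hnear.iterLog_add_one_le h
        have hinv := hnear.two_le_iterLog h
        -- The iterated logarithm has grown by 1, so `m` may decrease by 1.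
        obtain ⟨T, hT, hTle⟩ := ih (m - 1) d hd1 hinv (by
          rcases m with _ | m
          · simp only [Nat.cast_zero, Nat.zero_sub] at hm ⊢
            linarith
          · push_cast at hm
            simp only [Nat.add_sub_cancel]
            linarith)
        refine ⟨_, .step (by omega) hge hk hq hd (by omega) hq0 hit' hF hT, ?_⟩
        have hkw : (kwTime Λ (k ^ 2 * (d + 1)) : ℝ) ≤
            2 * Λ * (iterLog (i + 1 + 1) Λ + R + 1) := by
          -- Since `d * k ≤ R * Λ`, the merged palette exceeds `Λ + 1` by a factor of at most `k *
          -- (R + 1)`, whose logarithm is at most `log^{(i+2)} Λ + R`.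
          refine kwTime_le (a := k * (R + 1)) hΛ (Nat.mul_pos (by omega) (by omega)) ?_ ?_
          · have hkΛ : k ≤ Λ := by
              have h1 := hkx.trans (hxlog i le_rfl)
              have h2 := logb_two_le_sub_one (x := Λ) (h 0 (by omega))
              have : (k : ℝ) ≤ Λ := by linarith
              exact_mod_cast this
            calc k ^ 2 * (d + 1) = k * (d * k) + k * k := by ring
              _ ≤ k * (R * Λ) + k * Λ := by gcongr
              _ ≤ k * (R + 1) * (Λ + 1) := by nlinarith [Nat.zero_le (k * (R + 1))]
          · push_cast
            rw [Real.logb_mul (by positivity) (by positivity), iterLog_succ, ← hx]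
            have h1 := Real.logb_le_logb_of_le (b := 2) (by norm_num) (by linarith) hkx
            have h2 := logb_two_natCast_le R
            linarith
        have hdc : ((dcIters k q (c * Λ ^ 2) * (2 * q) : ℕ) : ℝ) ≤ 2 * R * Λ := by
          have : dcIters k q (c * Λ ^ 2) * (2 * q) ≤ R * (2 * Λ) := by gcongr
          calc _ ≤ ((R * (2 * Λ) : ℕ) : ℝ) := by exact_mod_cast this
            _ = _ := by push_cast; ring
        push_cast at hdc ⊢
        exact deltaColor_time_le hR' hΛ' (by linarith) hd0 hdR hdx hkw hdc hTle hup hm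
  set M : ℝ := S * (R + 1) ^ (8 * R) with hM
  have hM0 : 0 ≤ M := by positivity
  obtain ⟨B, hB⟩ := exists_nat_ge (2 * (2 + M))
  have hcS : (c : ℝ) ≤ M := by nlinarith [hpow (8 * R), sq_nonneg ((R : ℝ) + 1)]
  refine ⟨Λ₀, B, fun Λ hΛ => ?_⟩
  have hfinal : ∀ T : ℕ, (T : ℝ) ≤ 2 * Λ * (2 + M) → T ≤ B * Λ := by
    intro T hT
    have : (T : ℝ) ≤ B * Λ := by
      have : (0 : ℝ) ≤ Λ := Nat.cast_nonneg Λ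
      nlinarith
    exact_mod_cast this
  have hlog := iterLog_logStar_le Λ
  rcases hl : logStar Λ with _ | i
  · rw [hl, iterLog_zero] at hlog
    refine ⟨_, .base (Or.inl (by omega)), hfinal _ ((kwTime_base_le (by omega) hΛ).trans ?_)⟩
    have h3 := Real.logb_le_logb_of_le (b := 2) (by norm_num)
      (show (0 : ℝ) < Λ by exact_mod_cast hΛ) hlog
    rw [Real.logb_self_eq_one (by norm_num)] at h3
    gcongr
    linarith
  · have h := fun j (hj : j ≤ i) => (two_lt_iterLog (n := Λ) (i := j) (by omega)).le
    obtain ⟨T, h1, h2⟩ := main i (8 * R) Λ hΛ h (by have := h i le_rfl; push_cast; linarith)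
    refine ⟨T, h1, hfinal T (h2.trans ?_)⟩
    rw [hl] at hlog
    gcongr

/-! ### Procedure Tradeoff-Delta-Color -/

section Tradeoff

variable {V : Type*} [Fintype V] {G : SimpleGraph V} [DecidableRel G.Adj]

/-- The programs `P` compute a legal colouring with at most `K` colours in at most `T` rounds. -/
def ColorsWithin (G : SimpleGraph V) [DecidableRel G.Adj] (P : V → Protocol Msg ℕ) (K T : ℝ) :
    Prop :=
  ∃ (T' K' : ℕ) (φ : G.Coloring (Fin K')), (K' : ℝ) ≤ K ∧ (T' : ℝ) ≤ T ∧
    ComputesWithin G P T' (fun v => (φ v : ℕ))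

theorem Runs.colorsWithin {T K : ℕ} {P : V → Protocol Msg ℕ} {out : V → ℕ} (h : Runs G T P out)
    (hleg : ∀ u v, G.Adj u v → out u ≠ out v) (hK : ∀ v, out v < K) {K' T' : ℝ}
    (hK' : (K : ℝ) ≤ K') (hT' : (T : ℝ) ≤ T') : ColorsWithin G P K' T' :=
  ⟨T, K, SimpleGraph.Coloring.mk (fun v => ⟨out v, hK v⟩) fun {u v} huv he =>
    hleg u v huv (Fin.mk.inj_iff.1 he), hK', hT', h.computesWithin⟩

theorem degLe_maxDegree : DegLe G (fun _ => []) G.maxDegree := fun v =>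
  (Finset.card_filter_le _ _).trans (G.degree_le_maxDegree v)

variable {c Λ₀ B X N : ℕ} {δ : ℝ}

/-- An iteration divides the degree bound by at most `2 * p`, so `hDlow` keeps it positive; it
multiplies degree bound times `p` by at most `3 * s`, so the palette condition in `hsched` survives.
Vertices of different classes are told apart by `idx`, hence the disjunction in the legality clause.
-/
theorem tradeoffLoop_spec (hc : 64 ≤ c)
    (hX : ∀ A : ℕ, 0 < A → (∃ i, linialSize A N i ≤ c * A ^ 2) ∧ linialSteps c A N ≤ X)
    (hB : ∀ Λ : ℕ, 1 ≤ Λ → ∃ T, DeltaBound c Λ₀ δ (logStar Λ) Λ T ∧ T ≤ B * Λ)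
    {ident : V → ℕ} (hinj : Function.Injective ident) (hN : ∀ v, ident v < N)
    {s Q : ℕ} (hs : 1 ≤ s) (sched : List (ℕ × ℕ)) (cls : V → List ℕ) (D P : ℕ) (idx : V → ℕ)
    (hdeg : DegLe G cls D) (hidx : ∀ v, idx v < P) (hD : 1 ≤ D)
    (hDlow : 2 ^ sched.length * (sched.map Prod.fst).prod ≤ D)
    (hsched : ∀ x ∈ sched, 0 < x.1 ∧ x.1 ^ 2 < x.2 ∧ x.1 ^ 3 ≤ x.2 ∧ x.2 ≤ Q ∧
      c * ((3 * s) ^ sched.length * D) ^ 2 ≤ x.2 ^ s) :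
    ∃ (T D' : ℕ) (out : V → ℕ), T ≤ sched.length * (X + 3 * s * (2 * Q)) + (X + B * D') ∧
      D' * (sched.map Prod.fst).prod ≤ (3 * s) ^ sched.length * D ∧
      Runs G T (fun v => tradeoffLoop c Λ₀ δ N (ident v) sched (cls v) D (idx v)) out ∧
      (∀ u v, G.Adj u v → (cls u = cls v ∨ idx u ≠ idx v) → out u ≠ out v) ∧
      ∀ v, out v < P * (sched.map Prod.fst).prod ^ 2 * (D' + 1) := by
  induction sched generalizing cls D P idx with
  | nil =>
    obtain ⟨φ, a1, a2, a3⟩ := linial_spec (c := c) hdeg hinj hN (hX D hD).1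
    obtain ⟨T, hT, hTle⟩ := hB D hD
    obtain ⟨T', col, b1, b2, b3, b4⟩ := deltaColor_spec hT hdeg a2 a3
    refine ⟨_, D, fun v => idx v * (D + 1) + col v, ?_, by simp, a1.bind (b2.bind (T' := 0)
      (Runs.pure _) rfl) rfl, fun u v huv h he => ?_, fun v => ?_⟩
    · have := (hX D hD).2
      simp only [List.length_nil, Nat.zero_mul, Nat.zero_add]
      omega
    · obtain ⟨h1, h2⟩ := eq_and_eq_of_add_mul_eq (m := D + 1) (a := col u) (a' := col v)
        (b := idx u) (b' := idx v) (b4 u) (b4 v) (by linarith)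
      rcases h with h | h
      · exact b3 huv h h1
      · exact h h2
    · have := add_mul_lt_mul (b4 v) (hidx v)
      simp only [List.map_nil, List.prod_nil, one_pow, mul_one]
      linarith
  | cons x sched ih =>
    obtain ⟨p, q⟩ := x
    obtain ⟨hp, hpq, hpq', hqQ, hχ⟩ := hsched _ List.mem_cons_self
    simp only [List.map_cons, List.prod_cons, List.length_cons] at hDlow hsched hp hpq hpq' hqQ hχ ⊢
    set pr := (sched.map Prod.fst).prod with hpr
    set l := sched.length with hl
    have hpr0 : 0 < pr := by
      apply List.prod_pos
      intro a ha
      obtain ⟨y, hy, rfl⟩ := List.mem_map.1 ha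
      exact (hsched y (List.mem_cons_of_mem _ hy)).1
    have hpD : p ≤ D := by
      refine le_trans ?_ hDlow
      calc p = 1 * (p * 1) := by ring
        _ ≤ 2 ^ (l + 1) * (p * pr) := by gcongr; exacts [Nat.one_le_two_pow, hpr0]
    have hDD : D ≤ (3 * s) ^ (l + 1) * D := Nat.le_mul_of_pos_left _ (by positivity)
    have hχ' : c * D ^ 2 ≤ q ^ s := le_trans (by gcongr) hχ
    obtain ⟨hit, hit'⟩ := dcIters_spec hp hpq hpq' hχ'
    have hit1 : 1 ≤ dcIters p q (c * D ^ 2) := one_le_dcIters (by nlinarith) hit'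
    obtain ⟨φ, a1, a2, a3⟩ := linial_spec (c := c) hdeg hinj hN (hX D hD).1
    obtain ⟨T₁, j, b1, b2, b3, b4⟩ := defectiveColor_spec hp (by omega) hdeg a2 a3 hit'
    have hdp := dcDefect_mul_le (Λ := D) hit
    have hDd : D ≤ dcDefect p q (c * D ^ 2) D * (2 * p) :=
      (le_mul_two_mul_div hp hpD).trans
        (Nat.mul_le_mul_right _ (Nat.le_mul_of_pos_left _ hit1))
    set d := dcDefect p q (c * D ^ 2) D with hd
    have hlow : 2 ^ l * pr ≤ d := by
      refine Nat.le_of_mul_le_mul_right (c := 2 * p) ?_ (by omega)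
      calc 2 ^ l * pr * (2 * p) = 2 ^ (l + 1) * (p * pr) := by ring
        _ ≤ _ := hDlow.trans hDd
    have hd1 : 1 ≤ d := le_trans (Nat.mul_pos (by positivity) hpr0) hlow
    have hdD : d ≤ 3 * s * D := le_trans (Nat.le_mul_of_pos_right _ hp) hdp
    obtain ⟨T₂, D', out, c1, c2, c3, c4, c5⟩ := ih (fun v => j v :: cls v) d (P * p ^ 2)
      (fun v => idx v * p ^ 2 + j v) b3
      (fun v => by have := add_mul_lt_mul (b4 v) (hidx v); show idx v * p ^ 2 + j v < _; linarith)
      hd1 hlow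
      (fun y hy => by
        obtain ⟨h1, h2, h3, h4, h5⟩ := hsched y (List.mem_cons_of_mem _ hy)
        refine ⟨h1, h2, h3, h4, le_trans ?_ h5⟩
        calc c * ((3 * s) ^ l * d) ^ 2 ≤ c * ((3 * s) ^ l * (3 * s * D)) ^ 2 := by gcongr
          _ = _ := by ring)
    refine ⟨linialSteps c D N + (T₁ + T₂), D', out, ?_, ?_, a1.bind (b2.bind c3 rfl) rfl,
      fun u v huv h => c4 u v huv ?_, fun v => (c5 v).trans_le (le_of_eq (by ring))⟩
    · have h1 := (hX D hD).2
      have h2 : T₁ ≤ 3 * s * (2 * Q) := b1.trans (by gcongr)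
      rw [Nat.add_one_mul l]
      omega
    · calc D' * (p * pr) = D' * pr * p := by ring
        _ ≤ (3 * s) ^ l * d * p := by gcongr
        _ = (3 * s) ^ l * (d * p) := by ring
        _ ≤ (3 * s) ^ l * (3 * s * D) := by gcongr
        _ = _ := by ring
    · by_cases hj : j u = j v ∧ idx u = idx v
      · left
        exact congrArg₂ List.cons hj.1 (h.resolve_right (not_not.2 hj.2))
      · right
        intro he
        obtain ⟨h1, h2⟩ := eq_and_eq_of_add_mul_eq (m := p ^ 2) (a := j u) (a' := j v)
          (b := idx u) (b' := idx v) (b4 u) (b4 v) (by linarith)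
        exact hj ⟨h1, h2⟩

/-- Here `s = 8`, since `q ≥ Δ ^ (3 / 8)`. This gives `d * p ≤ 24 * Δ`, and `t ≤ 2 * p` turns it
into `d ≤ 48 * (Δ / t)`. -/
theorem colorsWithin_tradeoffSmall (hc : 64 ≤ c)
    (hX : ∀ A : ℕ, 0 < A → (∃ i, linialSize A N i ≤ c * A ^ 2) ∧ linialSteps c A N ≤ X)
    (hB : ∀ Λ : ℕ, 1 ≤ Λ → ∃ T, DeltaBound c Λ₀ δ (logStar Λ) Λ T ∧ T ≤ B * Λ)
    {ident : V → ℕ} (hinj : Function.Injective ident) (hN : ∀ v, ident v < N)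
    {Δ : ℕ} (hΔ : Δ = G.maxDegree) (hcΔ : c ^ 2 ≤ Δ) (h2 : 2 ≤ (Δ : ℝ) ^ (3 / 4 / 2 : ℝ))
    {t : ℝ} (ht : 1 < t) (htΔ : t < (Δ : ℝ) ^ (1 / 4 : ℝ)) :
    ColorsWithin G (fun v => tradeoffSmall c Λ₀ δ N Δ t (ident v))
      (25 * (Δ * t)) (X + 48 * (Δ / t) + 1 + 48 * B * (Δ / t)) := by
  obtain ⟨p, hp⟩ : ∃ p, p = ⌊t⌋₊ := ⟨_, rfl⟩
  obtain ⟨q, hq⟩ : ∃ q, q = ⌊(Δ : ℝ) ^ (3 / 4 : ℝ)⌋₊ := ⟨_, rfl⟩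
  have hΔ1 : 4096 ≤ Δ := le_trans (by nlinarith) hcΔ
  have hΔ1' : (4096 : ℝ) ≤ Δ := by exact_mod_cast hΔ1
  have hΔ0 : (0 : ℝ) < Δ := by linarith
  have hp1 : 1 ≤ p := by
    rw [hp]
    exact Nat.le_floor (by simpa using ht.le)
  have hpt : (p : ℝ) ≤ t := by
    rw [hp]
    exact Nat.floor_le (by linarith)
  have htp : t ≤ 2 * p := by
    have h1 := Nat.lt_floor_add_one t
    rw [← hp] at h1
    have : (1 : ℝ) ≤ p := by exact_mod_cast hp1
    linarith
  set y := (Δ : ℝ) ^ (1 / 4 : ℝ) with hy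
  have hy4 : y ^ 4 = Δ := by
    rw [hy, ← Real.rpow_mul_natCast hΔ0.le]
    norm_num
  have hy3 : (Δ : ℝ) ^ (3 / 4 : ℝ) = y ^ 3 := by
    rw [hy, ← Real.rpow_mul_natCast hΔ0.le]
    norm_num
  have hy0 : 0 < y := by linarith
  have hq2 : (2 : ℝ) ≤ q := h2.trans (hq ▸ rpow_half_le_floor hΔ0 h2)
  have hpq' : p ^ 3 ≤ q := by
    rw [hq, hy3]
    apply Nat.le_floor
    push_cast
    gcongr
    linarith
  have hpq : p ^ 2 < q := by
    rcases Nat.lt_or_ge 1 p with h | h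
    · exact (Nat.pow_lt_pow_right h (by norm_num)).trans_le hpq'
    · obtain rfl : p = 1 := by omega
      have : 2 ≤ q := by exact_mod_cast hq2
      omega
  have hχ : c * Δ ^ 2 ≤ q ^ 8 := by
    calc c * Δ ^ 2 ≤ Δ * Δ ^ 2 := Nat.mul_le_mul_right _ (by nlinarith)
      _ = Δ ^ 3 := by ring
      _ ≤ q ^ 8 := pow_le_pow_of_rpow_le 3 (by omega) (hq ▸ rpow_half_le_floor hΔ0 h2)
        (by norm_num)
  have hpΔ : (2 * p) ^ 2 ≤ Δ := by
    have h1 : (4 : ℝ) ≤ y ^ 2 := by nlinarith [sq_nonneg (y ^ 2), sq_nonneg (y ^ 2 - 4)]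
    have h3 : (2 * (p : ℝ)) ^ 2 ≤ Δ := by
      calc (2 * (p : ℝ)) ^ 2 = 4 * p ^ 2 := by ring
        _ ≤ y ^ 2 * y ^ 2 := by gcongr; linarith
        _ = Δ := by rw [← hy4]; ring
    exact_mod_cast h3
  obtain ⟨hit, hit'⟩ := dcIters_spec hp1 hpq hpq' hχ
  obtain ⟨hdlow, hF⟩ := dcDefect_spec hc hp1 hpq hpq' hχ hpΔ hcΔ
  have hdp := dcDefect_mul_le (Λ := Δ) hit
  obtain ⟨d, hd⟩ : ∃ d, d = dcDefect p q (c * Δ ^ 2) Δ := ⟨_, rfl⟩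
  rw [← hd] at hdlow hF hdp
  have hd1 : 1 ≤ d := by
    by_contra! h
    rw [Nat.lt_one_iff.1 h] at hdlow
    omega
  have hdeg : DegLe G (fun _ => []) Δ := hΔ ▸ degLe_maxDegree
  obtain ⟨lam, a1, a2, a3⟩ := linial_spec (c := c) hdeg hinj hN (hX Δ (by omega)).1
  obtain ⟨T₁, j, b1, b2, b3, b4⟩ := defectiveColor_spec hp1 (by omega) hdeg a2 a3 hit'
  rw [← hd] at b3
  obtain ⟨φ, c1, c2, c3⟩ := reduceColors_spec b3 (a2.cons j) a3 hF
  obtain ⟨T, hT, hTle⟩ := hB d hd1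
  obtain ⟨T₂, col, d1, d2, d3, d4⟩ := deltaColor_spec hT b3 c2 c3
  have hruns : Runs G (linialSteps c Δ N + (T₁ + (1 + T₂)))
      (fun v => tradeoffSmall c Λ₀ δ N Δ t (ident v)) (fun v => j v * (d + 1) + col v) := by
    simp only [tradeoffSmall]
    rw [← hp, ← hq, ← hd]
    exact a1.bind (b2.bind (c1.bind (d2.bind (T' := 0) (Runs.pure _) rfl) rfl) rfl) rfl
  have hdp' : (d : ℝ) * p ≤ 24 * Δ := by exact_mod_cast hdp
  have hpΔ' : (p : ℝ) ≤ Δ := by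
    have : p ≤ Δ := by nlinarith
    exact_mod_cast this
  have hd0 : (0 : ℝ) ≤ d := Nat.cast_nonneg d
  have hp0 : (0 : ℝ) ≤ p := Nat.cast_nonneg p
  refine hruns.colorsWithin (K := p ^ 2 * (d + 1)) (fun u v huv he => ?_) (fun v => ?_) ?_ ?_
  · obtain ⟨h1, h2⟩ := eq_and_eq_of_add_mul_eq (m := d + 1) (a := col u) (a' := col v)
      (b := j u) (b' := j v) (d4 u) (d4 v) (by linarith)
    exact d3 huv (by simp [h2]) h1
  · have := add_mul_lt_mul (d4 v) (b4 v)
    linarith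
  · push_cast
    calc (p : ℝ) ^ 2 * (d + 1) = p * (d * p + p) := by ring
      _ ≤ t * (24 * Δ + Δ) := by gcongr
      _ = _ := by ring
  · have hqt : (q : ℝ) ≤ Δ / t := by
      rw [le_div_iff₀ (by linarith)]
      calc (q : ℝ) * t ≤ y ^ 3 * y := by
            gcongr
            rw [hq, ← hy3]
            exact Nat.floor_le (by positivity)
        _ = Δ := by rw [← hy4]; ring
    have hdt : (d : ℝ) ≤ 48 * (Δ / t) := by
      rw [← mul_div_assoc, le_div_iff₀ (by linarith)]
      nlinarith
    have h1 : (linialSteps c Δ N : ℝ) ≤ X := by exact_mod_cast (hX Δ (by omega)).2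
    have h3 : (T₁ : ℝ) ≤ 48 * (Δ / t) := by
      have : T₁ ≤ 24 * (2 * q) := b1.trans (by gcongr)
      have : (T₁ : ℝ) ≤ 24 * (2 * q) := by exact_mod_cast this
      linarith
    have h4 : (T₂ : ℝ) ≤ B * d := by exact_mod_cast d1.trans hTle
    have h5 : (B : ℝ) * d ≤ B * (48 * (Δ / t)) := by gcongr
    push_cast
    linarith

theorem colorsWithin_tradeoffLoop_nil (hc : 64 ≤ c)
    (hX : ∀ A : ℕ, 0 < A → (∃ i, linialSize A N i ≤ c * A ^ 2) ∧ linialSteps c A N ≤ X)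
    (hB : ∀ Λ : ℕ, 1 ≤ Λ → ∃ T, DeltaBound c Λ₀ δ (logStar Λ) Λ T ∧ T ≤ B * Λ)
    {ident : V → ℕ} (hinj : Function.Injective ident) (hN : ∀ v, ident v < N)
    {Δ : ℕ} (hΔ : Δ = G.maxDegree) (hΔ1 : 1 ≤ Δ) :
    ColorsWithin G (fun v => tradeoffLoop c Λ₀ δ N (ident v) [] [] Δ 0) (Δ + 1) (X + B * Δ) := by
  obtain ⟨T, D, out, h1, h2, h3, h4, h5⟩ := tradeoffLoop_spec (s := 1) (Q := 0) hc hX hB hinj hN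
    le_rfl [] (fun _ => []) Δ 1 (fun _ => 0) (hΔ ▸ degLe_maxDegree) (fun _ => Nat.one_pos) hΔ1
    (by simpa using hΔ1) (by simp)
  simp only [List.map_nil, List.prod_nil, List.length_nil, pow_zero, mul_one, one_mul, one_pow,
    zero_mul, zero_add] at h1 h2 h5
  refine h3.colorsWithin (fun u v huv => h4 u v huv (Or.inl rfl)) h5 ?_ ?_
  · exact_mod_cast Nat.succ_le_succ h2
  · exact_mod_cast h1.trans (by gcongr)

theorem tradeoffSchedule_length (Δ : ℕ) (t : ℝ) :
    (tradeoffSchedule Δ t).length = tradeoffL Δ t + 1 := by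
  simp [tradeoffSchedule]

theorem tradeoffSchedule_prod (Δ : ℕ) (t : ℝ) : ((tradeoffSchedule Δ t).map Prod.fst).prod =
    tradeoffP Δ t ^ tradeoffL Δ t * ⌊t / (tradeoffP Δ t : ℝ) ^ tradeoffL Δ t⌋₊ := by
  simp [tradeoffSchedule]

/-- The properties of the schedule of Procedure Tradeoff-Delta-Color, if `Δ ^ (1 / 4) ≤ t`. -/
theorem tradeoffSchedule_spec {Δ I : ℕ} {t η : ℝ} (ht : 1 < t) (htΔ : t ≤ Δ)
    (hη : 0 < η) (hI : 6 / η ≤ I) (hμ : (Δ : ℝ) ^ η ≤ min t (Δ / t))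
    (h2 : 2 ≤ (Δ : ℝ) ^ (η / 3 / 2)) :
    (tradeoffSchedule Δ t).length ≤ I + 1 ∧
      (((tradeoffSchedule Δ t).map Prod.fst).prod : ℝ) ≤ t ∧
      t ≤ 2 * ((tradeoffSchedule Δ t).map Prod.fst).prod ∧
      (tradeoffQ Δ t : ℝ) ≤ Δ / t ∧ Δ ^ 3 ≤ tradeoffQ Δ t ^ I ∧
      ∀ x ∈ tradeoffSchedule Δ t, 0 < x.1 ∧ x.1 ^ 2 < x.2 ∧ x.1 ^ 3 ≤ x.2 ∧
        x.2 = tradeoffQ Δ t := by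
  rw [tradeoffSchedule_length, tradeoffSchedule_prod]
  have hΔ1 : (1 : ℝ) < Δ := by linarith
  have hΔ0 : (0 : ℝ) < Δ := by linarith
  have hI6 : 6 ≤ η * I := by
    rw [div_le_iff₀ hη] at hI
    linarith
  set μ := min t (Δ / t) with hμdef
  have hμ0 : 0 < μ := lt_of_lt_of_le (by positivity) hμ
  set p := tradeoffP Δ t with hp
  set q := tradeoffQ Δ t with hq
  set L := tradeoffL Δ t with hL
  -- A power of `Δ` as lower bound for `p` is what bounds the number of iterations: `p ^ L ≤ t ≤ Δ`
  -- forces `L ≤ 6 / η`.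
  have hpη : (Δ : ℝ) ^ (η / 3 / 2) ≤ p := by
    refine (rpow_half_le_floor hΔ0 h2).trans ?_
    have : (Δ : ℝ) ^ (η / 3) ≤ μ ^ (1 / 3 : ℝ) := by
      rw [show η / 3 = η * (1 / 3) by ring, Real.rpow_mul hΔ0.le]
      gcongr
    exact_mod_cast Nat.floor_le_floor this
  have hqη : (Δ : ℝ) ^ (η / 2) ≤ q := by
    have h2' : 2 ≤ (Δ : ℝ) ^ (η / 2) :=
      h2.trans (Real.rpow_le_rpow_of_exponent_le hΔ1.le (by linarith))
    exact (rpow_half_le_floor hΔ0 h2').trans (by exact_mod_cast Nat.floor_le_floor hμ)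
  have hp2' : (2 : ℝ) ≤ p := h2.trans hpη
  have hp2 : 2 ≤ p := by exact_mod_cast hp2'
  have hp1' : (1 : ℝ) < p := by linarith
  have hpq : p ^ 3 ≤ q := by
    apply Nat.le_floor
    push_cast
    calc (p : ℝ) ^ 3 ≤ (μ ^ (1 / 3 : ℝ)) ^ 3 := by
          gcongr
          exact Nat.floor_le (by positivity)
      _ = μ := by
          rw [← Real.rpow_mul_natCast hμ0.le]
          norm_num
  have hlog0 : 0 ≤ Real.logb p t := Real.logb_nonneg hp1' ht.le
  have hL1 : (p : ℝ) ^ L ≤ t := by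
    rw [← Real.rpow_natCast, ← Real.le_logb_iff_rpow_le hp1' (by linarith)]
    exact Nat.floor_le hlog0
  have hL2 : t < (p : ℝ) ^ (L + 1) := by
    rw [← Real.rpow_natCast, ← Real.logb_lt_iff_lt_rpow hp1' (by linarith)]
    push_cast
    exact Nat.lt_floor_add_one _
  have hpL : (0 : ℝ) < (p : ℝ) ^ L := by positivity
  -- The last parameter lies between 1 and `p` and brings the product within a factor 2 of `t`;
  -- without it the product could miss `t` by a factor of almost `p`.
  set p' := ⌊t / (p : ℝ) ^ L⌋₊ with hp'
  have hp'1 : 1 ≤ p' := by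
    apply Nat.le_floor
    rw [Nat.cast_one, le_div_iff₀ hpL]
    linarith
  have hp'le : (p' : ℝ) ≤ t / (p : ℝ) ^ L := Nat.floor_le (by positivity)
  have hp'lt : t / (p : ℝ) ^ L ≤ 2 * p' := by
    have h1 := Nat.lt_floor_add_one (t / (p : ℝ) ^ L)
    have : (1 : ℝ) ≤ p' := by exact_mod_cast hp'1
    linarith
  have hp'p : p' ≤ p := by
    have : (p' : ℝ) ≤ p := by
      refine hp'le.trans ?_
      rw [div_le_iff₀ hpL]
      calc t ≤ (p : ℝ) ^ (L + 1) := hL2.le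
        _ = _ := by ring
    exact_mod_cast this
  refine ⟨?_, ?_, ?_, ?_, ?_, ?_⟩
  · have h1 : (Δ : ℝ) ^ (η / 3 / 2 * L) ≤ (Δ : ℝ) ^ (1 : ℝ) := by
      rw [Real.rpow_mul hΔ0.le, Real.rpow_natCast, Real.rpow_one]
      calc ((Δ : ℝ) ^ (η / 3 / 2)) ^ L ≤ (p : ℝ) ^ L := by gcongr
        _ ≤ Δ := hL1.trans htΔ
    rw [Real.rpow_le_rpow_left_iff hΔ1] at h1
    have h3 : (L : ℝ) ≤ I := by nlinarith
    have : L ≤ I := by exact_mod_cast h3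
    omega
  · push_cast
    rw [le_div_iff₀ hpL] at hp'le
    linarith
  · push_cast
    rw [div_le_iff₀ hpL] at hp'lt
    linarith
  · exact (Nat.floor_le hμ0.le).trans (min_le_right _ _)
  · exact pow_le_pow_of_rpow_le 3 (by exact_mod_cast hΔ1.le) hqη (by push_cast; linarith)
  · have hmain : ∀ a, 0 < a → a ≤ p → 0 < a ∧ a ^ 2 < q ∧ a ^ 3 ≤ q := by
      intro a ha hap
      refine ⟨ha, ?_, (Nat.pow_le_pow_left hap 3).trans hpq⟩
      exact ((Nat.pow_le_pow_left hap 2).trans_lt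
        (Nat.pow_lt_pow_right hp2 (by norm_num))).trans_le hpq
    intro x hx
    rw [tradeoffSchedule, List.mem_append] at hx
    rcases hx with hx | hx
    · rw [List.eq_of_mem_replicate hx]
      obtain ⟨h1, h2, h3⟩ := hmain p (by omega) le_rfl
      exact ⟨h1, h2, h3, rfl⟩
    · rw [List.mem_singleton.1 hx]
      obtain ⟨h1, h2, h3⟩ := hmain p' hp'1 hp'p
      exact ⟨h1, h2, h3, rfl⟩

theorem colorsWithin_tradeoffLoop (hc : 64 ≤ c)
    (hX : ∀ A : ℕ, 0 < A → (∃ i, linialSize A N i ≤ c * A ^ 2) ∧ linialSteps c A N ≤ X)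
    (hB : ∀ Λ : ℕ, 1 ≤ Λ → ∃ T, DeltaBound c Λ₀ δ (logStar Λ) Λ T ∧ T ≤ B * Λ)
    {ident : V → ℕ} (hinj : Function.Injective ident) (hN : ∀ v, ident v < N)
    {Δ I R : ℕ} (hΔ : Δ = G.maxDegree) {t η : ℝ} (ht : 1 < t) (htΔ : t ≤ Δ)
    (hη : 0 < η) (hI : 6 / η ≤ I) (hI1 : 1 ≤ I) (hμ : (Δ : ℝ) ^ η ≤ min t (Δ / t))
    (h2 : 2 ≤ (Δ : ℝ) ^ (η / 3 / 2)) (hR : R = (3 * I) ^ (I + 1)) (hΔR : c * R ^ 2 ≤ Δ)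
    (hΔI : 2 ^ (I + 1) ≤ (Δ : ℝ) ^ η) :
    ColorsWithin G (fun v => tradeoffLoop c Λ₀ δ N (ident v) (tradeoffSchedule Δ t) [] Δ 0)
      ((R + 1) * (Δ * t))
      ((I + 1) * (X + 6 * I * (Δ / t)) + (X + B * (2 * R * (Δ / t)))) := by
  obtain ⟨a1, a2, a3, a4, a5, a6⟩ := tradeoffSchedule_spec ht htΔ hη hI hμ h2
  have hΔ1' : (1 : ℝ) ≤ Δ := by linarith
  have hΔ1 : 1 ≤ Δ := by exact_mod_cast hΔ1'
  set l := (tradeoffSchedule Δ t).length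
  have hlR : (3 * I) ^ l ≤ R := by
    rw [hR]
    exact Nat.pow_le_pow_right (by omega) a1
  have hdist : c * ((3 * I) ^ l * Δ) ^ 2 ≤ tradeoffQ Δ t ^ I := by
    calc c * ((3 * I) ^ l * Δ) ^ 2 ≤ c * (R * Δ) ^ 2 := by gcongr
      _ = c * R ^ 2 * Δ ^ 2 := by ring
      _ ≤ Δ * Δ ^ 2 := by gcongr
      _ = Δ ^ 3 := by ring
      _ ≤ _ := a5
  -- The room for the factors 2 comes from `Δ / t ≥ Δ ^ η ≥ 2 ^ (I + 1)`.
  have hlow : 2 ^ l * ((tradeoffSchedule Δ t).map Prod.fst).prod ≤ Δ := by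
    have h3 : (2 : ℝ) ^ (I + 1) ≤ Δ / t := hΔI.trans (hμ.trans (min_le_right _ _))
    rw [le_div_iff₀ (by linarith)] at h3
    have h4 : (2 : ℝ) ^ l * ((tradeoffSchedule Δ t).map Prod.fst).prod ≤ Δ := by
      refine le_trans ?_ h3
      gcongr
      norm_num
    exact_mod_cast h4
  obtain ⟨T, D, out, h3, h4, h5, h6, h7⟩ := tradeoffLoop_spec (Q := tradeoffQ Δ t) hc hX hB hinj hN
    hI1 (tradeoffSchedule Δ t) (fun _ => []) Δ 1 (fun _ => 0) (hΔ ▸ degLe_maxDegree)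
    (fun _ => Nat.one_pos) hΔ1 hlow (fun x hx => by
      obtain ⟨b1, b2, b3, b4⟩ := a6 x hx
      exact ⟨b1, b2, b3, b4.le, b4 ▸ hdist⟩)
  set pr := ((tradeoffSchedule Δ t).map Prod.fst).prod
  have hDpr : (D : ℝ) * pr ≤ R * Δ := by
    have : D * pr ≤ R * Δ := h4.trans (by gcongr)
    exact_mod_cast this
  refine h5.colorsWithin (fun u v huv => h6 u v huv (Or.inl rfl)) h7 ?_ ?_
  · push_cast
    calc 1 * (pr : ℝ) ^ 2 * (D + 1) = pr * (D * pr + pr) := by ring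
      _ ≤ t * (R * Δ + Δ) := by
        gcongr
        exact_mod_cast a2.trans htΔ
      _ = _ := by ring
  · have hDt : (D : ℝ) ≤ 2 * R * (Δ / t) := by
      rw [← mul_div_assoc, le_div_iff₀ (by linarith)]
      have := mul_le_mul_of_nonneg_left a3 (Nat.cast_nonneg (α := ℝ) D)
      linarith
    have h8 : (T : ℝ) ≤ l * (X + 3 * I * (2 * tradeoffQ Δ t)) + (X + B * D) := by
      exact_mod_cast h3
    have h9 : (l : ℝ) ≤ I + 1 := by exact_mod_cast a1
    calc (T : ℝ) ≤ l * (X + 3 * I * (2 * tradeoffQ Δ t)) + (X + B * D) := h8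
      _ ≤ (I + 1) * (X + 3 * I * (2 * (Δ / t))) + (X + B * (2 * R * (Δ / t))) := by gcongr
      _ = _ := by ring

theorem three_le_card_of_two_le_maxDegree (h : 2 ≤ G.maxDegree) : 3 ≤ Fintype.card V := by
  rcases isEmpty_or_nonempty V with hV | hV
  · have := G.maxDegree_le_of_forall_degree_le 0 fun v => isEmptyElim v
    omega
  · have := G.maxDegree_lt_card_verts
    omega

theorem ColorsWithin.mono {P : V → Protocol Msg ℕ} {K T K' T' : ℝ} (h : ColorsWithin G P K T)
    (hK : K ≤ K') (hT : T ≤ T') : ColorsWithin G P K' T' := by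
  obtain ⟨T₀, K₀, φ, h1, h2, h3⟩ := h
  exact ⟨T₀, K₀, φ, h1.trans hK, h2.trans hT, h3⟩

end Tradeoff

end DistColor

/-! ### Choice of the constants and the three cases of the main theorem. -/

open DistColor in
theorem mainTheorem2 :
    ∃ c : ℕ, ∀ δ : ℝ, 0 < δ → δ < 1 → ∃ Λ₀ : ℕ,
      ∀ ε : ℝ, 0 < ε → ε < 1 → ∃ Δ₀ I : ℕ, ∀ κ : ℕ, ∃ C : ℝ, 0 < C ∧
        ∀ (V : Type*) [Fintype V] (G : SimpleGraph V) [DecidableRel G.Adj] (ident : V → ℕ),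
          Function.Injective ident → (∀ v, ident v ≤ Fintype.card V ^ κ) →
          ∀ t : ℝ, 1 < t → t ≤ (G.maxDegree : ℝ) ^ (1 - ε) →
            DistColor.tradeoffIters Δ₀ G.maxDegree t ≤ I ∧
            ∃ (T K : ℕ) (φ : G.Coloring (Fin K)),
              (K : ℝ) ≤ C * (G.maxDegree * t) ∧
              (T : ℝ) ≤ C * (G.maxDegree / t + DistColor.logStar (Fintype.card V)) ∧
              DistColor.ComputesWithin G
                (fun v => DistColor.tradeoffDeltaColor c Λ₀ Δ₀ δ (Fintype.card V ^ κ + 1)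
                  G.maxDegree t (ident v))
                T (fun v => (φ v : ℕ)) := by
  obtain ⟨c, hc, hX⟩ := exists_linialSteps_le
  refine ⟨c, fun δ hδ hδ1 => ?_⟩
  obtain ⟨Λ₀, B, hB⟩ := exists_deltaBound hc hδ hδ1
  refine ⟨Λ₀, fun ε hε hε1 => ?_⟩
  -- In the last case `t ≥ Δ ^ (1 / 4)` and `Δ / t ≥ Δ ^ ε`, so both are at least `Δ ^ η`.
  set η := min ε (1 / 4) with hηdef
  have hη : 0 < η := lt_min hε (by norm_num)
  obtain ⟨I, hI⟩ := exists_nat_ge (6 / η)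
  have hI1 : 1 ≤ I := by
    have : (0 : ℝ) < I := lt_of_lt_of_le (by positivity) hI
    exact_mod_cast this
  obtain ⟨R, hR⟩ : ∃ R, R = (3 * I) ^ (I + 1) := ⟨_, rfl⟩
  have hev : ∀ᶠ x : ℝ in atTop, (2 : ℝ) ≤ x ^ (3 / 4 / 2 : ℝ) ∧ 2 ≤ x ^ (η / 3 / 2) ∧
      (2 : ℝ) ^ (I + 1) ≤ x ^ η :=
    (eventually_le_rpow (by norm_num) 2).and
      ((eventually_le_rpow (by positivity) 2).and (eventually_le_rpow hη _))
  obtain ⟨Δ₁, hΔ₁⟩ := eventually_atTop.1 (tendsto_natCast_atTop_atTop.eventually hev)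
  set Δ₀ := Δ₁ + c ^ 2 + c * R ^ 2 with hΔ₀
  refine ⟨Δ₀, I + 1, fun κ => ?_⟩
  obtain ⟨Y, hY⟩ := hX κ
  -- One summand for each of the three cases of the procedure.
  set C : ℝ := (2 + Y + B * Δ₀) + (25 + Y + 49 + 48 * B) +
    ((R + 1) + (I + 1) * (Y + 6 * I) + Y + 2 * B * R) with hC
  refine ⟨C, by positivity, fun V _ G _ ident hinj hid t ht htΔ => ?_⟩
  obtain ⟨Δ, hΔ⟩ : ∃ Δ, Δ = G.maxDegree := ⟨_, rfl⟩
  rw [← hΔ] at htΔ ⊢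
  -- For `Δ ≤ 1` no `t` is admissible. From `Δ ≥ 2` it follows that `n ≥ 3`, as the bound on
  -- Linial's algorithm requires.
  have hΔ2 : 2 ≤ Δ := by
    by_contra! h
    have h0 : 1 - ε ≠ 0 := by linarith
    interval_cases Δ
    · rw [Nat.cast_zero, Real.zero_rpow h0] at htΔ
      linarith
    · rw [Nat.cast_one, Real.one_rpow] at htΔ
      linarith
  have hΔ2' : (2 : ℝ) ≤ Δ := by exact_mod_cast hΔ2
  have hΔ0 : (0 : ℝ) < Δ := by linarith
  have hΔt : (Δ : ℝ) ^ ε ≤ Δ / t := by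
    rw [le_div_iff₀ (by linarith)]
    calc (Δ : ℝ) ^ ε * t ≤ (Δ : ℝ) ^ ε * (Δ : ℝ) ^ (1 - ε) := by gcongr
      _ = Δ := by rw [← Real.rpow_add hΔ0, add_sub_cancel, Real.rpow_one]
  have htΔ' : t ≤ Δ := by
    refine htΔ.trans ?_
    calc (Δ : ℝ) ^ (1 - ε) ≤ (Δ : ℝ) ^ (1 : ℝ) :=
          Real.rpow_le_rpow_of_exponent_le (by linarith) (by linarith)
      _ = Δ := Real.rpow_one _
  have hone : 1 ≤ Δ / t := by
    rw [le_div_iff₀ (by linarith)]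
    linarith
  obtain ⟨ls, hls⟩ : ∃ ls, ls = logStar (Fintype.card V) := ⟨_, rfl⟩
  rw [← hls]
  have hls0 : (0 : ℝ) ≤ ls := Nat.cast_nonneg ls
  have hn := three_le_card_of_two_le_maxDegree (hΔ ▸ hΔ2)
  have hX' : ∀ A : ℕ, 0 < A → (∃ i, linialSize A (Fintype.card V ^ κ + 1) i ≤ c * A ^ 2) ∧
      linialSteps c A (Fintype.card V ^ κ + 1) ≤ Y * ls := fun A hA => hls ▸ hY _ hn A hA
  have hN : ∀ v, ident v < Fintype.card V ^ κ + 1 := fun v => Nat.lt_succ_of_le (hid v)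
  have hcomb : ∀ a b d : ℝ, 0 ≤ a → a + b + d ≤ C → 0 ≤ b → 0 ≤ d →
      a * (Δ * t) ≤ C * (Δ * t) ∧ b * ls + d * (Δ / t) ≤ C * (Δ / t + ls) := by
    intro a b d ha h hb hd
    have h1 : 0 ≤ Δ * t := by positivity
    constructor
    · gcongr
      linarith
    · have h2 : b * ls ≤ C * ls := by gcongr; linarith
      have h3 : d * (Δ / t) ≤ C * (Δ / t) := by gcongr; linarith
      linarith
  change _ ∧ ColorsWithin G _ _ _
  rcases Nat.lt_or_ge Δ Δ₀ with hlt | hge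
  · simp only [tradeoffDeltaColor, tradeoffIters, if_pos hlt]
    refine ⟨Nat.zero_le _, ?_⟩
    obtain ⟨h1, h2⟩ := hcomb 2 Y (B * Δ₀) (by norm_num) (by
      have : 0 ≤ (25 + Y + 49 + 48 * B) +
        ((R + 1) + (I + 1) * (Y + 6 * I) + Y + 2 * B * R : ℝ) := by positivity
      linarith) (by positivity) (by positivity)
    refine (colorsWithin_tradeoffLoop_nil hc hX' hB hinj hN hΔ (by omega)).mono
      (le_trans ?_ h1) (le_trans ?_ h2)
    · nlinarith
    -- For bounded `Δ` any constant number of rounds is affordable, because `Δ / t ≥ 1`.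
    · have h3 : (Δ : ℝ) ≤ Δ₀ * (Δ / t) := by
        have : (Δ : ℝ) ≤ Δ₀ := by exact_mod_cast hlt.le
        nlinarith
      have h4 : (B : ℝ) * Δ ≤ B * (Δ₀ * (Δ / t)) := by gcongr
      push_cast at h4 ⊢
      linarith
  · obtain ⟨e1, e2, e3⟩ := hΔ₁ Δ (by omega)
    have hnlt : ¬ Δ < Δ₀ := by omega
    by_cases htsmall : t < (Δ : ℝ) ^ (1 / 4 : ℝ)
    · simp only [tradeoffDeltaColor, tradeoffIters, if_neg hnlt, if_pos htsmall]
      refine ⟨by omega, ?_⟩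
      obtain ⟨h1, h2⟩ := hcomb 25 Y (49 + 48 * B) (by norm_num) (by
        have : 0 ≤ (2 + Y + B * Δ₀) +
          ((R + 1) + (I + 1) * (Y + 6 * I) + Y + 2 * B * R : ℝ) := by positivity
        linarith) (by positivity) (by positivity)
      refine (colorsWithin_tradeoffSmall hc hX' hB hinj hN hΔ (by omega) e1 ht htsmall).mono
        h1 (le_trans ?_ h2)
      push_cast
      linarith
    · simp only [tradeoffDeltaColor, tradeoffIters, if_neg hnlt, if_neg htsmall]
      have hμ : (Δ : ℝ) ^ η ≤ min t (Δ / t) := by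
        refine le_min ?_ ?_
        · exact (Real.rpow_le_rpow_of_exponent_le (by linarith) (min_le_right _ _)).trans
            (not_lt.1 htsmall)
        · exact (Real.rpow_le_rpow_of_exponent_le (by linarith) (min_le_left _ _)).trans hΔt
      refine ⟨(tradeoffSchedule_spec ht htΔ' hη hI hμ e2).1, ?_⟩
      obtain ⟨h1, h2⟩ := hcomb (R + 1) ((I + 1) * Y + Y) ((I + 1) * (6 * I) + 2 * B * R)
        (by positivity) (by
          have : 0 ≤ (2 + Y + B * Δ₀) + (25 + Y + 49 + 48 * B : ℝ) := by positivity
          linarith) (by positivity) (by positivity)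
      refine (colorsWithin_tradeoffLoop hc hX' hB hinj hN hΔ ht htΔ' hη hI hI1 hμ e2 hR
        (by omega) e3).mono h1 (le_trans ?_ h2)
      push_cast
      linarith
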